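/- **Setting.** Let $0<\alpha_-<\alpha_+$, $J=[\alpha_-,\alpha_+]$, let $\lambda$ be Lebesgue measure on $[0,1]$, and let $\mathcal M(I,\alpha_-,\alpha_+)$ be the class of families of maps $f_\alpha:[0,1]\to[0,1]$, $\alpha\in J$, with the following properties. 1. There are $m\ge 2$ and disjoint non-trivial intervals $I_1,\dots,I_m\subset[0,1]$, independent of $\alpha$, whose union has full Lebesgue measure. 2. For all $\alpha\in J$, $1\le i\le m$: $\overline{f_\alpha(I_i)}=[0,1]$, and $f_\alpha|_{I_i}$ extends to a $C^3$ diffeomorphism $f_{\alpha,i}$ from an open set containing $\overline{I_i}$ onto its image, except that $f_{\alpha,1}$ is only required to be a $C^1$ diffeomorphism that is $C^3$ away from the point $0$. The map $(\alpha,x)\mapsto f_{\alpha,i}'(x)$ is continuous on $J\times\overline{I_i}$, and $(\alpha,x)\mapsto f_{\alpha,i}''(x)$ is continuous on $J\times \overline{I_i}$ (on $J\times(\overline{I_1}\setminus\{0\})$ if $i=1$). 3. There is $\sigma>1$ with $|f_{\alpha,i}'|>\sigma$ on $I_i$ for all $\alpha\in J$, $2\le i\le m$. Moreover $0\in\overline{I_1}$,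 $f_{\alpha,1}(0)=0$ and $f_{\alpha,1}'(x)>1$ for $x\in\overline{I_1}\setminus\{0\}$. 4. There are a continuous $\alpha\mapsto b_\alpha\in(0,\infty)$ on $J$, $\epsilon>0$ and $C>0$ with $|f_{\alpha,1}'(x)-(1+b_\alpha(1+\alpha)x^\alpha)|\le Cx^{\alpha+\epsilon}$ for all $\alpha\in J$, $x\in I_1$. 5. For $1\le i\le m$ and $x\in\overline{I_i}$, the functions $\alpha\mapsto f_{\alpha,i}^{-1}(x)$, $(f_{\alpha,i}^{-1})'(x)$, $(f_{\alpha,i}^{-1})''(x)$ are $C^1$ on $J$ (the last one is not required if $i=1$, $x=0$). Here $f_{\alpha,i}^{-1}:[0,1]\to\overline{I_i}$. 6. Put $Y=\bigcup_{i=2}^m\overline{I_i}$, $F^{-1}_{\alpha,(i,k)}=f_{\alpha,i}^{-1}\circ f_{\alpha,1}^{-(k-1)}:Y\to Y$, and let $G_{\alpha,(i,k)},G'_{\alpha,(i,k)},G''_{\alpha,(i,k)}$ be the absolute values of the first, second and third $x$-derivatives of $F^{-1}_{\alpha,(i,k)}$. There are $K_0>0$ and $\gamma_{(i,k)}\ge1$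 such that for all $\alpha\in J$, $2\le i\le m$, $k\ge1$, with sup norms over $Y$ and all $\alpha$-derivatives existing: $\|G'/G\|_\infty\le K_0$, $\|G''/G\|_\infty\le K_0$, $\|\partial_\alpha F^{-1}\|_\infty\le\gamma_{(i,k)}$, $\|\partial_\alpha G/G\|_\infty\le\gamma_{(i,k)}$, $\|\partial_\alpha G'/G\|_\infty\le\gamma_{(i,k)}$ (each at $\alpha,(i,k)$), and $\sum_{i=2}^m\sum_{k\ge1}\|G_{\alpha,(i,k)}\|_\infty\gamma_{(i,k)}\le K_0$. Let $\tau_\alpha(x)=\inf\{n\ge1: f_\alpha^n(x)\in Y\}$ for $x\in Y$, let $\tilde\lambda=\lambda(Y)^{-1}\lambda|_Y$, and let $h_\alpha\in C^2(Y)$ be the invariant density of the first return map: $h_\alpha$ is bounded above and below by positive constants, $\int_Y h_\alpha\,d\tilde\lambda=1$, and $\sum_{i=2}^m\sum_{k\ge1}G_{\alpha,(i,k)}\cdot h_\alpha\circ F^{-1}_{\alpha,(i,k)}=h_\alpha$ on $Y$. Let $\nu_\alpha=\sum_{n\ge0}\sum_{k\ge n+1}(h_\alpha\,d\tilde\lambda)|_{\{\tau_\alpha=k\}}\circ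 f_\alpha^{-n}$. **Proposition.** Let $\{f_\alpha\}_{\alpha\in J}\in\mathcal M(I,\alpha_-,\alpha_+)$, with $b_\alpha$ and $\epsilon$ as in 4, where $\epsilon<\alpha_-$ and $\epsilon\le1$ (which can always be achieved by decreasing $\epsilon$). Then there is a constant $D>0$ such that for all $\alpha\in J$ and all integers $n\ge1$ $$\left|\nu_\alpha(\{\tau_\alpha>n\})-c_\alpha n^{-1/\alpha}\right|\le D\,n^{-(1+\epsilon)/\alpha},\qquad c_\alpha=\frac{\sum_{i=2}^m h_\alpha(f_{\alpha,i}^{-1}(0))\,|(f_{\alpha,i}^{-1})'(0)|}{\lambda(Y)\,(\alpha b_\alpha)^{1/\alpha}}.$$ -/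

import Mathlib

open Set MeasureTheory

/-- The data of a one-parameter family of piecewise monotone maps of `[0,1]`: the number `m` of
branches, the intervals `I 1, …, I m`, the maps `f α` (only their values on `[0,1]` matter), and
the extensions `br α i` of the branches `f α|_{I i}` past the closure of `I i`.
Indices `i` outside `{1, …, m}` are irrelevant. -/
structure BranchedFamily where
  m : ℕ
  I : ℕ → Set ℝ
  f : ℝ → ℝ → ℝ
  br : ℝ → ℕ → ℝ → ℝ

namespace BranchedFamily

variable (S : BranchedFamily)

/-- The inducing domain `Y = ⋃_{i = 2}^m closure (I i)`. -/
def Y : Set ℝ := ⋃ i ∈ Finset.Icc 2 S.m, closure (S.I i)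

/-- The first return time `τ_α(x) = inf {n ≥ 1 : f_α^n(x) ∈ Y}`, with `inf ∅ = ∞`. -/
noncomputable def returnTime (α x : ℝ) : ℕ∞ :=
  sInf ((fun n : ℕ => (n : ℕ∞)) '' {n : ℕ | 1 ≤ n ∧ (S.f α)^[n] x ∈ S.Y})

/-- The inverse branch `f_{α,i}⁻¹ : [0,1] → closure (I i)`. -/
noncomputable def brInv (α : ℝ) (i : ℕ) : ℝ → ℝ :=
  Function.invFunOn (S.br α i) (closure (S.I i))

/-- The inverse branches `F_{α,(i,k)}⁻¹ = f_{α,i}⁻¹ ∘ f_{α,1}^{-(k-1)}` (`k ≥ 1`) of the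
first return map. -/
noncomputable def indInv (α : ℝ) (i k : ℕ) (x : ℝ) : ℝ :=
  S.brInv α i ((S.brInv α 1)^[k - 1] x)

/-- `|dʲ/dxʲ F_{α,(i,k)}⁻¹|` on `Y`: this is `G`, `G'`, `G''` for `j = 1, 2, 3`. -/
noncomputable def G (j : ℕ) (α : ℝ) (i k : ℕ) (x : ℝ) : ℝ :=
  |iteratedDerivWithin j (S.indInv α i k) S.Y x|

/-- The points of `closure (I i)` other than the indifferent fixed point `0` of the first
branch. -/
def regularPart (i : ℕ) : Set ℝ := closure (S.I i) \ {x | i = 1 ∧ x = 0}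

/-- The class of families of intermittent maps with parameters in `[αm, αp]`, where `b` and `ε`
are the coefficient and the exponent in the expansion of the first branch at `0`. -/
structure IsIntermittent (αm αp : ℝ) (b : ℝ → ℝ) (ε : ℝ) : Prop where
  mapsTo : ∀ α ∈ Icc αm αp, MapsTo (S.f α) (Icc 0 1) (Icc 0 1)
  -- the partition
  two_le : 2 ≤ S.m
  subset_unit : ∀ i ∈ Finset.Icc 1 S.m, S.I i ⊆ Icc 0 1
  ordConnected : ∀ i ∈ Finset.Icc 1 S.m, (S.I i).OrdConnected
  nontrivial : ∀ i ∈ Finset.Icc 1 S.m, (S.I i).Nontrivial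
  disjoint : ∀ i ∈ Finset.Icc 1 S.m, ∀ j ∈ Finset.Icc 1 S.m, i ≠ j → Disjoint (S.I i) (S.I j)
  null_compl : volume (Icc (0 : ℝ) 1 \ ⋃ i ∈ Finset.Icc 1 S.m, S.I i) = 0
  -- the branches: full, and extending to `C³` diffeomorphisms of a neighbourhood of the closure
  -- (the first one is `C¹` at the indifferent fixed point `0` and `C³` away from it)
  full : ∀ α ∈ Icc αm αp, ∀ i ∈ Finset.Icc 1 S.m, closure (S.f α '' S.I i) = Icc 0 1
  eqOn : ∀ α ∈ Icc αm αp, ∀ i ∈ Finset.Icc 1 S.m, EqOn (S.f α) (S.br α i) (S.I i)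
  extends_diffeo : ∀ α ∈ Icc αm αp, ∀ i ∈ Finset.Icc 1 S.m, ∃ W : Set ℝ, IsOpen W ∧
    closure (S.I i) ⊆ W ∧ InjOn (S.br α i) W ∧ ContDiffOn ℝ 1 (S.br α i) W ∧
    ContDiffOn ℝ 3 (S.br α i) (W \ {x | i = 1 ∧ x = 0}) ∧ ∀ x ∈ W, deriv (S.br α i) x ≠ 0
  continuous_deriv : ∀ i ∈ Finset.Icc 1 S.m,
    ContinuousOn (fun p : ℝ × ℝ => deriv (S.br p.1 i) p.2) (Icc αm αp ×ˢ closure (S.I i))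
  continuous_deriv2 : ∀ i ∈ Finset.Icc 1 S.m,
    ContinuousOn (fun p : ℝ × ℝ => iteratedDeriv 2 (S.br p.1 i) p.2)
      (Icc αm αp ×ˢ S.regularPart i)
  -- expansion
  expanding : ∃ σ : ℝ, 1 < σ ∧ ∀ α ∈ Icc αm αp, ∀ i ∈ Finset.Icc 2 S.m, ∀ x ∈ S.I i,
    σ < |deriv (S.br α i) x|
  zero_mem : (0 : ℝ) ∈ closure (S.I 1)
  fixed_zero : ∀ α ∈ Icc αm αp, S.br α 1 0 = 0
  one_lt_deriv : ∀ α ∈ Icc αm αp, ∀ x ∈ closure (S.I 1) \ {0}, 1 < deriv (S.br α 1) x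
  -- the indifferent fixed point
  b_continuous : ContinuousOn b (Icc αm αp)
  b_pos : ∀ α ∈ Icc αm αp, 0 < b α
  ε_pos : 0 < ε
  indifferent : ∃ C : ℝ, 0 < C ∧ ∀ α ∈ Icc αm αp, ∀ x ∈ S.I 1,
    |deriv (S.br α 1) x - (1 + b α * (1 + α) * x ^ α)| ≤ C * x ^ (α + ε)
  -- `C¹` dependence of the inverse branches on the parameter
  param_inv : ∀ i ∈ Finset.Icc 1 S.m, ∀ x ∈ closure (S.I i),
    ContDiffOn ℝ 1 (fun α => S.brInv α i x) (Icc αm αp)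
  param_inv1 : ∀ i ∈ Finset.Icc 1 S.m, ∀ x ∈ closure (S.I i),
    ContDiffOn ℝ 1 (fun α => derivWithin (S.brInv α i) (Icc 0 1) x) (Icc αm αp)
  param_inv2 : ∀ i ∈ Finset.Icc 1 S.m, ∀ x ∈ S.regularPart i,
    ContDiffOn ℝ 1 (fun α => iteratedDerivWithin 2 (S.brInv α i) (Icc 0 1) x) (Icc αm αp)
  -- distortion and parameter dependence of the inverse branches of the first return map
  induced : ∃ K : ℝ, 0 < K ∧ ∃ γ : ℕ → ℕ → ℝ,
    (∀ i ∈ Finset.Icc 2 S.m, ∀ k, 1 ≤ k → 1 ≤ γ i k) ∧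
    (∀ α ∈ Icc αm αp, ∀ i ∈ Finset.Icc 2 S.m, ∀ k, 1 ≤ k → ∀ x ∈ S.Y,
      S.G 2 α i k x / S.G 1 α i k x ≤ K ∧
      S.G 3 α i k x / S.G 1 α i k x ≤ K ∧
      DifferentiableWithinAt ℝ (fun a => S.indInv a i k x) (Icc αm αp) α ∧
      |derivWithin (fun a => S.indInv a i k x) (Icc αm αp) α| ≤ γ i k ∧
      DifferentiableWithinAt ℝ (fun a => S.G 1 a i k x) (Icc αm αp) α ∧
      |derivWithin (fun a => S.G 1 a i k x) (Icc αm αp) α / S.G 1 α i k x| ≤ γ i k ∧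
      DifferentiableWithinAt ℝ (fun a => S.G 2 a i k x) (Icc αm αp) α ∧
      |derivWithin (fun a => S.G 2 a i k x) (Icc αm αp) α / S.G 1 α i k x| ≤ γ i k) ∧
    ∀ α ∈ Icc αm αp, ∑ i ∈ Finset.Icc 2 S.m, ∑' k : ℕ,
      (⨆ x ∈ S.Y, ENNReal.ofReal (S.G 1 α i (k + 1) x)) * ENNReal.ofReal (γ i (k + 1))
        ≤ ENNReal.ofReal K

/-- The Ruelle operator `P_α u (x) = ∑_{i = 2}^m ∑_{k ≥ 1} G_{α,(i,k)}(x) u(F_{α,(i,k)}⁻¹(x))`. -/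
noncomputable def ruelle (α : ℝ) (u : ℝ → ℝ) (x : ℝ) : ℝ :=
  ∑ i ∈ Finset.Icc 2 S.m, ∑' k : ℕ, S.G 1 α i (k + 1) x * u (S.indInv α i (k + 1) x)

/-- The measure `h dλ̃` on `Y`, where `λ̃ = λ(Y)⁻¹ λ|_Y` is normalized Lebesgue measure. -/
noncomputable def inducedMeasure (h : ℝ → ℝ) : Measure ℝ :=
  ((volume S.Y)⁻¹ • volume.restrict S.Y).withDensity fun x => ENNReal.ofReal (h x)

/-- `h` is the invariant density `h_α` of the first return map: a `C²` function on `Y`, bounded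
away from `0` and `∞`, fixed by the Ruelle operator, with `h dλ̃` of total mass one. -/
structure IsInvariantDensity (α : ℝ) (h : ℝ → ℝ) : Prop where
  contDiffOn : ContDiffOn ℝ 2 h S.Y
  mass : S.inducedMeasure h S.Y = 1
  fixed : ∀ x ∈ S.Y, S.ruelle α h x = h x
  bounds : ∃ D : ℝ, 1 ≤ D ∧ ∀ x ∈ S.Y, D⁻¹ ≤ h x ∧ h x ≤ D

/-- The SRB measure
`ν_α = ∑_{n ≥ 0} ∑_{k ≥ n + 1} (h dλ̃)|_{τ_α = k} ∘ f_α^{-n}` built from the density `h`. -/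
noncomputable def srbMeasure (α : ℝ) (h : ℝ → ℝ) : Measure ℝ :=
  Measure.sum fun n : ℕ => Measure.sum fun j : ℕ =>
    ((S.inducedMeasure h).restrict
      {x | x ∈ S.Y ∧ S.returnTime α x = ((n + 1 + j : ℕ) : ℕ∞)}).map (S.f α)^[n]

/-- The leading coefficient
`c_α = λ(Y)⁻¹ ∑_{i = 2}^m h(f_{α,i}⁻¹(0)) |(f_{α,i}⁻¹)'(0)| / (α b_α)^{1/α}`. -/
noncomputable def tailCoeff (b : ℝ → ℝ) (α : ℝ) (h : ℝ → ℝ) : ℝ :=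
  (volume S.Y).toReal⁻¹ *
    (∑ i ∈ Finset.Icc 2 S.m,
      h (S.brInv α i 0) * |derivWithin (S.brInv α i) (Icc 0 1) 0|) / (α * b α) ^ (1 / α)

end BranchedFamily

/-!
For almost every `x ∈ I i` with `i ≥ 2`, the return time `τ_α(x)` exceeds `n` exactly when
`f_{α,i}(x) < z_n`, where `z_n = f_{α,1}⁻ⁿ(1)` is the backward orbit of `1` under the first branch
(`tailSet_succ_diff`). On these tail sets the SRB measure is the induced measure `h_α dλ̃`, because
the other terms in its definition live on orbits outside `Y` (`srbMeasure_tailSet`). Changing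
variables by the inverse branches, `ν_α(τ_α > n)` becomes `λ(Y)⁻¹` times the integral over
`[0, z_n)` of `∑ i, |(f_{α,i}⁻¹)'| · h_α ∘ f_{α,i}⁻¹`. Two facts, both
uniform in `α`, then give the result.

The first one is `z_n = (α b_α n)^(-1/α) + O(n^(-(1+ε)/α))` (`backOrbit_asymptotics`). The relation
`z_n = z_{n+1} + b_α z_{n+1}^(1+α) + O(z_{n+1}^(1+α+ε))` shows that `z_n^(-α)` has increments
`α b_α + O(z_{n+1}^ε)` that are bounded below (`rpow_neg_step`), so these errors are
`O(n^(-ε/α))`, and their sum is `O(n^(1-ε/α))` as `ε < αm`.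

The second one is that the integrand is its value at `0` up to `O(z_n)`
(`exists_branchDensity_bounds`). Only the density needs more than compactness: by bounded
distortion of the induced branches and their contraction by a factor `θ < 1`, the equation
`P_α h = h` turns a logarithmic Lipschitz constant `L` of `h` into `K + θ L` (`ruelle_distortion_step`).
Iterating, `K / (1 - θ)` is such a constant for each invariant density (`exists_density_distortion`), and the
normalization `∫ h dλ̃ = 1` bounds the density itself (`exists_density_bounds`).

The resulting error `O(z_n²) = O(n^(-2/α))` is of the claimed order because `ε ≤ 1`.
-/

/-! ### Elementary inequalities for real powers -/

/-- The second order Taylor bound for `(1 + s)^(-α)`, valid for all `s ≥ 0` and not only near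
`0`. -/
theorem abs_one_add_rpow_neg_sub_le {s α : ℝ} (hs : 0 ≤ s) (hα : 0 < α) :
    |1 - (1 + s) ^ (-α) - α * s| ≤ (α + α ^ 2 / 2) * s ^ 2 := by
  have h1 : 0 < 1 + s := by linarith
  set l := Real.log (1 + s) with hl
  have hl0 : 0 ≤ l := Real.log_nonneg (by linarith)
  have hl1 : l ≤ s := by have := Real.log_le_sub_one_of_pos h1; linarith
  have hl2 : s - s ^ 2 ≤ l := by
    have h2 : 1 - (1 + s)⁻¹ ≤ l := Real.one_sub_inv_le_log_of_pos h1
    have h3 : s - s ^ 2 ≤ 1 - (1 + s)⁻¹ := by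
      have : 1 - (1 + s)⁻¹ - (s - s ^ 2) = s ^ 3 / (1 + s) := by field_simp; ring
      have : 0 ≤ s ^ 3 / (1 + s) := by positivity
      linarith
    linarith
  rw [Real.rpow_def_of_pos h1, ← hl]
  set t := α * l with ht
  have ht0 : 0 ≤ t := by positivity
  have e1 : 1 - t ≤ Real.exp (l * -α) := by
    have := Real.add_one_le_exp (l * -α)
    have : l * -α = -t := by rw [ht]; ring
    linarith
  have e2 : Real.exp (l * -α) ≤ 1 - t + t ^ 2 / 2 := by
    have : l * -α = -t := by rw [ht]; ring
    rw [this, Real.exp_neg]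
    -- `(1 + t + t²/2) (1 - t + t²/2) = 1 + t⁴/4 ≥ 1`
    have hq := Real.quadratic_le_exp_of_nonneg ht0
    have hp : 0 < 1 + t + t ^ 2 / 2 := by positivity
    refine (inv_anti₀ hp hq).trans ?_
    rw [inv_le_iff_one_le_mul₀ hp]
    nlinarith [sq_nonneg (t ^ 2)]
  have e3 : t ≤ α * s := by rw [ht]; gcongr
  have e4 : α * s - α * s ^ 2 ≤ t := by
    rw [ht]; nlinarith
  have e5 : t ^ 2 ≤ α ^ 2 * s ^ 2 := by
    rw [← mul_pow]; gcongr
  rw [abs_le]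
  constructor <;> nlinarith [sq_nonneg s]

/-- A quantitative form of `(1 + s)^(-α) < 1`, uniform for `α` in a compact interval. -/
theorem one_sub_one_add_rpow_neg_ge {s w δ α αm αp : ℝ} (hαm : 0 < αm) (hα : α ∈ Icc αm αp)
    (hδ : 0 < δ) (hδ1 : δ ≤ 1) (hw : 0 < w) (hw1 : w ≤ 1) (hs : δ * w ≤ s) :
    αm * δ / (2 * (1 + αp)) * w ≤ 1 - (1 + s) ^ (-α) := by
  have hα0 : 0 < α := hαm.trans_le hα.1
  have hαp : 0 < αp := hα0.trans_le hα.2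
  have hv : 0 < δ * w := by positivity
  have hv1 : δ * w ≤ 1 := by nlinarith
  have h0 : (1 + s) ^ (-α) ≤ (1 + δ * w) ^ (-α) :=
    Real.rpow_le_rpow_of_nonpos (by positivity) (by linarith) (by linarith)
  have hl : δ * w / 2 ≤ Real.log (1 + δ * w) := by
    have h2 : 1 - (1 + δ * w)⁻¹ ≤ Real.log (1 + δ * w) :=
      Real.one_sub_inv_le_log_of_pos (by linarith)
    have h3 : δ * w / 2 ≤ 1 - (1 + δ * w)⁻¹ := by
      have e : 1 - (1 + δ * w)⁻¹ = δ * w / (1 + δ * w) := by field_simp; ring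
      rw [e]; gcongr; linarith
    linarith
  set t := αm * (δ * w / 2) with ht
  have ht0 : 0 < t := by positivity
  have htp : t ≤ αp := by
    have : αm ≤ αp := hα.1.trans hα.2
    nlinarith
  have h4 : (1 + δ * w) ^ (-α) ≤ (1 + t)⁻¹ := by
    rw [Real.rpow_def_of_pos (by linarith)]
    have : Real.log (1 + δ * w) * -α ≤ -t := by
      have : t ≤ α * Real.log (1 + δ * w) := by
        rw [ht]; exact mul_le_mul hα.1 hl (by positivity) hα0.le
      linarith
    refine (Real.exp_le_exp.2 this).trans ?_
    rw [Real.exp_neg]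
    exact inv_anti₀ (by linarith) (by have := Real.add_one_le_exp t; linarith)
  have h5 : αm * δ / (2 * (1 + αp)) * w ≤ 1 - (1 + t)⁻¹ := by
    have e : 1 - (1 + t)⁻¹ = t / (1 + t) := by field_simp; ring
    have e2 : αm * δ / (2 * (1 + αp)) * w = t / (1 + αp) := by rw [ht]; field_simp
    rw [e, e2]; gcongr
  linarith

theorem sum_rpow_neg_le {p : ℝ} (hp0 : 0 < p) (hp1 : p < 1) (n : ℕ) :
    ∑ k ∈ Finset.range n, ((k : ℝ) + 1) ^ (-p) ≤ (n : ℝ) ^ (1 - p) / (1 - p) := by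
  have hq : 0 < 1 - p := by linarith
  induction n with
  | zero => simp [Real.zero_rpow hq.ne']
  | succ n ih =>
    rw [Finset.sum_range_succ]
    have hn : (0 : ℝ) < n + 1 := by positivity
    -- Bernoulli's inequality for the concave power `q = 1 - p`:
    -- `n^q ≤ (n+1)^q (1 - q/(n+1))`
    have hB : (1 + -(1 / ((n : ℝ) + 1))) ^ (1 - p) ≤ 1 + (1 - p) * -(1 / ((n : ℝ) + 1)) := by
      apply rpow_one_add_le_one_add_mul_self _ hq.le (by linarith)
      have : 1 / ((n : ℝ) + 1) ≤ 1 := by rw [div_le_one hn]; linarith [n.cast_nonneg (α := ℝ)]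
      linarith
    have e1 : (n : ℝ) ^ (1 - p) = (n + 1 : ℝ) ^ (1 - p) * (1 + -(1 / ((n : ℝ) + 1))) ^ (1 - p) := by
      rw [← Real.mul_rpow hn.le]
      · congr 1; field_simp; ring
      · have : 1 / ((n : ℝ) + 1) ≤ 1 := by rw [div_le_one hn]; linarith [n.cast_nonneg (α := ℝ)]
        linarith
    have e2 : (n + 1 : ℝ) ^ (-p) = (n + 1 : ℝ) ^ (1 - p) * (1 / ((n : ℝ) + 1)) := by
      rw [Real.rpow_sub hn, Real.rpow_neg hn.le, Real.rpow_one]; field_simp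
    have hpos : 0 < (n + 1 : ℝ) ^ (1 - p) := by positivity
    push_cast
    rw [le_div_iff₀ hq] at ih ⊢
    rw [add_mul, e2]
    nlinarith [mul_le_mul_of_nonneg_left hB hpos.le]

theorem abs_rpow_neg_sub_rpow_neg_le {v w c r : ℝ} (hc : 0 < c) (hv : c ≤ v) (hw : c ≤ w)
    (hr : 0 < r) : |v ^ (-r) - w ^ (-r)| ≤ r * c ^ (-r - 1) * |v - w| := by
  have := Convex.norm_image_sub_le_of_norm_hasDerivWithin_le (f := fun t : ℝ => t ^ (-r))
    (f' := fun t => -r * t ^ (-r - 1)) (s := Ici c) (x := w) (y := v) (C := r * c ^ (-r - 1))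
    (fun x hx => (Real.hasDerivAt_rpow_const
      (Or.inl (hc.trans_le hx).ne')).hasDerivWithinAt) ?_ (convex_Ici c) hw hv
  · simpa [Real.norm_eq_abs] using this
  · intro x hx
    have hx0 : 0 < x := hc.trans_le hx
    rw [norm_mul, Real.norm_eq_abs, Real.norm_eq_abs, abs_neg, abs_of_pos hr,
      abs_of_pos (by positivity)]
    exact mul_le_mul_of_nonneg_left (Real.rpow_le_rpow_of_nonpos hc hx (by linarith)) hr.le

/-! ### Backward orbits of an indifferent fixed point -/

/-- One step of the backward orbit of an indifferent fixed point: if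
`y = x + b x^(1+α) + O(x^(1+α+ε))`, then `x^(-α)` exceeds `y^(-α)` by `α b + O(x^ε)`. -/
theorem rpow_neg_step {αm αp bM ε C δ α b x y : ℝ} (hαm : 0 < αm) (hα : α ∈ Icc αm αp)
    (hb0 : 0 < b) (hb : b ≤ bM) (hεα : ε < αm) (hC : 0 < C) (hδ : 0 < δ) (hδ1 : δ ≤ 1)
    (hx : 0 < x) (hx1 : x ≤ 1)
    (h1 : |y - x - b * x ^ (1 + α)| ≤ C * x ^ (1 + α + ε)) (h2 : δ * x ^ (1 + α) ≤ y - x)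
    (hε : 0 < ε) :
    αm * δ / (2 * (1 + αp)) ≤ x ^ (-α) - y ^ (-α) ∧
      |x ^ (-α) - y ^ (-α) - α * b|
        ≤ (αp * C + (αp + αp ^ 2 / 2) * (bM + C) ^ 2) * x ^ ε := by
  have hα0 : 0 < α := hαm.trans_le hα.1
  have hαp : 0 < αp := hα0.trans_le hα.2
  have hw0 : 0 < x ^ α := by positivity
  have hw1 : x ^ α ≤ 1 := Real.rpow_le_one hx.le hx1 hα0.le
  -- since `ε < αm ≤ α`, the quadratic Taylor error `O(x^α)` is absorbed by `O(x^ε)`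
  have hwε : x ^ α ≤ x ^ ε := Real.rpow_le_rpow_of_exponent_ge hx hx1 (by linarith [hα.1])
  have hxε0 : 0 < x ^ ε := by positivity
  have hxε1 : x ^ ε ≤ 1 := Real.rpow_le_one hx.le hx1 hε.le
  -- with `y = x (1 + s)` the difference is `x^(-α) (1 - (1 + s)^(-α))`, where `s ≈ b x^α`
  have e1 : x ^ (1 + α) = x * x ^ α := by rw [Real.rpow_add hx, Real.rpow_one]
  have e2 : x ^ (1 + α + ε) = x * x ^ α * x ^ ε := by rw [Real.rpow_add hx, e1]
  rw [e1] at h1 h2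
  rw [e2] at h1
  obtain ⟨s, hs⟩ : ∃ s, y = x * (1 + s) := ⟨(y - x) / x, by field_simp; ring⟩
  subst hs
  set w := x ^ α with hw
  have hs1 : δ * w ≤ s := by
    have : x * (δ * w) ≤ x * s := by linarith
    exact le_of_mul_le_mul_left this hx
  have hs0 : 0 ≤ s := le_trans (by positivity) hs1
  have hs2 : |s - b * w| ≤ C * w * x ^ ε := by
    have : x * (1 + s) - x - b * (x * w) = x * (s - b * w) := by ring
    rw [this, abs_mul, abs_of_pos hx] at h1
    refine le_of_mul_le_mul_left (h1.trans_eq (by ring)) hx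
  have hs3 : s ≤ (bM + C) * w := by
    have h3 := (abs_le.1 hs2).2
    have h4 : C * w * x ^ ε ≤ C * w := by
      have : 0 < C * w := by positivity
      nlinarith
    nlinarith
  have e3 : x ^ (-α) = w⁻¹ := by rw [Real.rpow_neg hx.le]
  have e4 : x ^ (-α) - (x * (1 + s)) ^ (-α) = w⁻¹ * (1 - (1 + s) ^ (-α)) := by
    rw [Real.mul_rpow hx.le (by linarith), e3]; ring
  rw [e4]
  constructor
  · have := one_sub_one_add_rpow_neg_ge hαm hα hδ hδ1 hw0 hw1 hs1
    rw [inv_mul_eq_div, le_div_iff₀ hw0]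
    exact this
  · have hT := abs_one_add_rpow_neg_sub_le hs0 hα0
    have hbC : 0 ≤ bM + C := by linarith
    have h5 : |1 - (1 + s) ^ (-α) - α * b * w|
        ≤ (αp * C + (αp + αp ^ 2 / 2) * (bM + C) ^ 2) * x ^ ε * w := by
      have e5 : 1 - (1 + s) ^ (-α) - α * b * w
          = (1 - (1 + s) ^ (-α) - α * s) + α * (s - b * w) := by ring
      rw [e5]
      refine (abs_add_le _ _).trans ?_
      have h6 : |α * (s - b * w)| ≤ αp * (C * w * x ^ ε) := by
        rw [abs_mul, abs_of_pos hα0]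
        exact mul_le_mul hα.2 hs2 (abs_nonneg _) hαp.le
      have h7 : (α + α ^ 2 / 2) * s ^ 2
          ≤ (αp + αp ^ 2 / 2) * ((bM + C) ^ 2 * (w * x ^ ε)) := by
        have h8 : s ^ 2 ≤ (bM + C) ^ 2 * (w * x ^ ε) := by
          calc s ^ 2 ≤ ((bM + C) * w) ^ 2 := by gcongr
            _ = (bM + C) ^ 2 * (w * w) := by ring
            _ ≤ _ := by gcongr
        have h9 : α + α ^ 2 / 2 ≤ αp + αp ^ 2 / 2 := by
          have := hα.2
          gcongr
        exact mul_le_mul h9 h8 (by positivity) (by positivity)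
      linarith
    have e6 : w⁻¹ * (1 - (1 + s) ^ (-α)) - α * b
        = (1 - (1 + s) ^ (-α) - α * b * w) / w := by field_simp
    rw [e6, abs_div, abs_of_pos hw0, div_le_iff₀ hw0]
    exact h5

/-- Uniform asymptotics `z n = (α b n)^(-1/α) (1 + O(n^(-ε/α)))` of the backward orbit of an
indifferent fixed point. The sequence `u n = z n ^ (-α)` grows at least linearly, so that its
increments are `α b + O(n^(-ε/α))`; as `ε / α ≤ ε / αm < 1`, these errors sum to
`O(n^(1 - ε/α))`. -/
theorem backward_orbit_asymptotics {αm αp bm bM ε C δ : ℝ} (hαm : 0 < αm) (hαp : αm < αp)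
    (hbm : 0 < bm) (hε : 0 < ε) (hεα : ε < αm) (hC : 0 < C) (hδ : 0 < δ) (hδ1 : δ ≤ 1) :
    ∃ D : ℝ, 0 < D ∧ ∀ α ∈ Icc αm αp, ∀ b ∈ Icc bm bM, ∀ z : ℕ → ℝ, z 0 = 1 →
      (∀ n, 0 < z n) → (∀ n, z n ≤ 1) →
      (∀ n, |z n - z (n + 1) - b * z (n + 1) ^ (1 + α)| ≤ C * z (n + 1) ^ (1 + α + ε)) →
      (∀ n, δ * z (n + 1) ^ (1 + α) ≤ z n - z (n + 1)) → ∀ n : ℕ, 1 ≤ n →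
        z n ≤ D * (n : ℝ) ^ (-(1 / α)) ∧
        |z n - (α * b) ^ (-(1 / α)) * (n : ℝ) ^ (-(1 / α))|
          ≤ D * (n : ℝ) ^ (-((1 + ε) / α)) := by
  have hαp0 : 0 < αp := hαm.trans hαp
  set c := αm * δ / (2 * (1 + αp)) with hc
  have hc0 : 0 < c := by positivity
  have hc1 : c ≤ 1 := by
    rw [hc, div_le_one (by positivity)]; nlinarith
  set E := αp * C + (αp + αp ^ 2 / 2) * (bM + C) ^ 2 with hE
  have hE0 : 0 < E := by positivity
  set p₀ := ε / αm with hp₀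
  have hp₀1 : p₀ < 1 := by rw [hp₀, div_lt_one hαm]; exact hεα
  set E₂ := E / c / (1 - p₀) + 1 with hE₂
  have hE₂0 : 0 < E₂ := by
    have : 0 < 1 - p₀ := by linarith
    positivity
  -- a common lower bound for `z n ^ (-α) / n` and its limit `α b`
  set c₂ := min c (αm * bm) with hc₂
  have hc₂0 : 0 < c₂ := lt_min hc0 (by positivity)
  have hc₂1 : c₂ ≤ 1 := (min_le_left _ _).trans hc1
  refine ⟨c₂ ^ (-(1 / αm)) + 1 / αm * c₂ ^ (-(1 / αm) - 1) * E₂, by positivity, ?_⟩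
  intro α hα b hb z hz0 hzpos hz1 hexp hlow n hn
  have hα0 : 0 < α := hαm.trans_le hα.1
  have hn0 : (0 : ℝ) < n := by exact_mod_cast hn
  have hb0 : 0 < b := hbm.trans_le hb.1
  set p := ε / α with hp
  have hp0 : 0 < p := by positivity
  have hpp₀ : p ≤ p₀ := by rw [hp, hp₀]; exact div_le_div_of_nonneg_left hε.le hαm hα.1
  have hp1 : p < 1 := hpp₀.trans_lt hp₀1
  have step := fun k => rpow_neg_step hαm hα hb0 hb.2 hεα hC hδ hδ1 (hzpos (k + 1)) (hz1 (k + 1))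
    (hexp k) (hlow k) hε
  have hulow : ∀ k : ℕ, c * k ≤ z k ^ (-α) := by
    intro k
    induction k with
    | zero => simp [hz0]
    | succ k ih => have := (step k).1; push_cast; linarith
  have hzε : ∀ k : ℕ, z (k + 1) ^ ε ≤ c⁻¹ * ((k : ℝ) + 1) ^ (-p) := by
    intro k
    have e : z (k + 1) ^ ε = (z (k + 1) ^ (-α)) ^ (-p) := by
      rw [← Real.rpow_mul (hzpos _).le, hp]; congr 1; field_simp
    have hk := hulow (k + 1)
    push_cast at hk
    rw [e]
    refine (Real.rpow_le_rpow_of_nonpos (by positivity) hk (by linarith)).trans ?_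
    rw [Real.mul_rpow hc0.le (by positivity), ← Real.rpow_neg_one c]
    exact mul_le_mul_of_nonneg_right
      (Real.rpow_le_rpow_of_exponent_ge hc0 hc1 (by linarith)) (by positivity)
  have hsum : ∀ k : ℕ, |z k ^ (-α) - 1 - α * b * k|
      ≤ E / c * ∑ j ∈ Finset.range k, ((j : ℝ) + 1) ^ (-p) := by
    intro k
    induction k with
    | zero => simp [hz0]
    | succ k ih =>
      rw [Finset.sum_range_succ, mul_add]
      have h1 : |z (k + 1) ^ (-α) - z k ^ (-α) - α * b| ≤ E / c * ((k : ℝ) + 1) ^ (-p) := by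
        refine (step k).2.trans ?_
        rw [div_eq_mul_inv E c, mul_assoc E]
        exact mul_le_mul_of_nonneg_left (hzε k) hE0.le
      have e : z (k + 1) ^ (-α) - 1 - α * b * ((k + 1 : ℕ) : ℝ)
          = (z k ^ (-α) - 1 - α * b * k) + (z (k + 1) ^ (-α) - z k ^ (-α) - α * b) := by
        push_cast; ring
      rw [e]
      exact (abs_add_le _ _).trans (add_le_add ih h1)
  have hu : |z n ^ (-α) - α * b * n| ≤ E₂ * (n : ℝ) ^ (1 - p) := by
    have h1 := (hsum n).trans (mul_le_mul_of_nonneg_left (sum_rpow_neg_le hp0 hp1 n)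
      (by positivity))
    -- the initial value `u 0 = 1` is absorbed by `n^(1 - p) ≥ 1`
    have h2 : (1 : ℝ) ≤ (n : ℝ) ^ (1 - p) :=
      Real.one_le_rpow (by exact_mod_cast hn) (by linarith)
    have h3 : E / c * ((n : ℝ) ^ (1 - p) / (1 - p)) ≤ E / c / (1 - p₀) * (n : ℝ) ^ (1 - p) := by
      rw [div_mul_eq_mul_div (E / c), mul_div_assoc]
      have : 0 < 1 - p₀ := by linarith
      gcongr
    have e : z n ^ (-α) - α * b * n = (z n ^ (-α) - 1 - α * b * n) + 1 := by ring
    rw [e]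
    refine (abs_add_le _ _).trans ?_
    rw [abs_one, hE₂, add_mul]
    linarith
  obtain ⟨v, hv⟩ : ∃ v, v = z n ^ (-α) / n := ⟨_, rfl⟩
  have hvc : c₂ ≤ v := by
    refine (min_le_left _ _).trans ?_
    rw [hv, le_div_iff₀ hn0]; exact hulow n
  have hβc : c₂ ≤ α * b := (min_le_right _ _).trans
    (mul_le_mul hα.1 hb.1 hbm.le hα0.le)
  have hv0 : 0 < v := hc₂0.trans_le hvc
  have hvb : |v - α * b| ≤ E₂ * (n : ℝ) ^ (-p) := by
    have e : v - α * b = (z n ^ (-α) - α * b * n) / n := by rw [hv]; field_simp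
    have e2 : (n : ℝ) ^ (1 - p) = n * (n : ℝ) ^ (-p) := by
      rw [sub_eq_add_neg, Real.rpow_add hn0, Real.rpow_one]
    rw [e, abs_div, abs_of_pos hn0, div_le_iff₀ hn0]
    rw [e2] at hu
    linarith
  have hzv : z n = v ^ (-(1 / α)) * (n : ℝ) ^ (-(1 / α)) := by
    rw [← Real.mul_rpow hv0.le hn0.le, hv, div_mul_cancel₀ _ hn0.ne', ← Real.rpow_mul (hzpos n).le]
    have : -α * -(1 / α) = 1 := by field_simp
    rw [this, Real.rpow_one]
  have hr : 1 / α ≤ 1 / αm := one_div_le_one_div_of_le hαm hα.1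
  have hr0 : 0 < 1 / α := by positivity
  have hA : v ^ (-(1 / α)) ≤ c₂ ^ (-(1 / αm)) :=
    (Real.rpow_le_rpow_of_nonpos hc₂0 hvc (by linarith)).trans
      (Real.rpow_le_rpow_of_exponent_ge hc₂0 hc₂1 (by linarith))
  constructor
  · rw [hzv]
    gcongr
    refine hA.trans (le_add_of_nonneg_right (by positivity))
  · have h1 : |v ^ (-(1 / α)) - (α * b) ^ (-(1 / α))|
        ≤ (1 / αm * c₂ ^ (-(1 / αm) - 1)) * (E₂ * (n : ℝ) ^ (-p)) := by
      refine (abs_rpow_neg_sub_rpow_neg_le hc₂0 hvc hβc hr0).trans ?_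
      refine mul_le_mul (mul_le_mul hr ?_ (by positivity) (by positivity)) hvb (abs_nonneg _)
        (by positivity)
      exact Real.rpow_le_rpow_of_exponent_ge hc₂0 hc₂1 (by linarith)
    have e : (n : ℝ) ^ (-((1 + ε) / α)) = (n : ℝ) ^ (-p) * (n : ℝ) ^ (-(1 / α)) := by
      rw [← Real.rpow_add hn0, hp]; congr 1; ring
    have hn1 : 0 < (n : ℝ) ^ (-(1 / α)) := by positivity
    rw [hzv, ← sub_mul, abs_mul, abs_of_pos hn1, e, ← mul_assoc]
    gcongr
    refine h1.trans ?_
    rw [← mul_assoc]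
    gcongr
    exact le_add_of_nonneg_left (by positivity)

/-! ### The partition and the inverse branches -/

theorem closure_eq_Icc_csInf_csSup {s : Set ℝ} (hs : s.OrdConnected) (hn : s.Nontrivial)
    (hb : Bornology.IsBounded s) :
    sInf s < sSup s ∧ Ioo (sInf s) (sSup s) ⊆ s ∧ closure s = Icc (sInf s) (sSup s) := by
  obtain ⟨x, hx, y, hy, hxy⟩ := hn.exists_lt
  have hlt : sInf s < sSup s :=
    (csInf_le hb.bddBelow hx).trans_lt (hxy.trans_le (le_csSup hb.bddAbove hy))
  have hsub : Ioo (sInf s) (sSup s) ⊆ s := by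
    intro t ht
    obtain ⟨u, hu, hut⟩ := exists_lt_of_csInf_lt ⟨x, hx⟩ ht.1
    obtain ⟨v, hv, htv⟩ := exists_lt_of_lt_csSup ⟨x, hx⟩ ht.2
    exact hs.out hu hv ⟨hut.le, htv.le⟩
  refine ⟨hlt, hsub, Subset.antisymm ?_ ?_⟩
  · exact closure_minimal (subset_Icc_csInf_csSup hb.bddBelow hb.bddAbove) isClosed_Icc
  · rw [← closure_Ioo hlt.ne]; exact closure_mono hsub

namespace BranchedFamily

/-- The left endpoint of the interval `I i`. -/
noncomputable def left (S : BranchedFamily) (i : ℕ) : ℝ := sInf (S.I i)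

/-- The right endpoint of the interval `I i`. -/
noncomputable def right (S : BranchedFamily) (i : ℕ) : ℝ := sSup (S.I i)

namespace IsIntermittent

variable {S : BranchedFamily} {αm αp : ℝ} {b : ℝ → ℝ} {ε : ℝ}

theorem one_mem (hS : S.IsIntermittent αm αp b ε) : 1 ∈ Finset.Icc 1 S.m :=
  Finset.mem_Icc.2 ⟨le_rfl, one_le_two.trans hS.two_le⟩

theorem mem_Icc_one {i : ℕ} (hi : i ∈ Finset.Icc 2 S.m) : i ∈ Finset.Icc 1 S.m :=
  Finset.Icc_subset_Icc one_le_two le_rfl hi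

theorem structure_I (hS : S.IsIntermittent αm αp b ε) {i : ℕ} (hi : i ∈ Finset.Icc 1 S.m) :
    S.left i < S.right i ∧ Ioo (S.left i) (S.right i) ⊆ S.I i ∧
      closure (S.I i) = Icc (S.left i) (S.right i) :=
  closure_eq_Icc_csInf_csSup (hS.ordConnected i hi) (hS.nontrivial i hi)
    ((Metric.isBounded_Icc 0 1).subset (hS.subset_unit i hi))

theorem left_lt_right (hS : S.IsIntermittent αm αp b ε) {i : ℕ} (hi : i ∈ Finset.Icc 1 S.m) :
    S.left i < S.right i := (hS.structure_I hi).1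

theorem Ioo_subset (hS : S.IsIntermittent αm αp b ε) {i : ℕ} (hi : i ∈ Finset.Icc 1 S.m) :
    Ioo (S.left i) (S.right i) ⊆ S.I i := (hS.structure_I hi).2.1

theorem closure_I (hS : S.IsIntermittent αm αp b ε) {i : ℕ} (hi : i ∈ Finset.Icc 1 S.m) :
    closure (S.I i) = Icc (S.left i) (S.right i) := (hS.structure_I hi).2.2

theorem closure_subset_unit (hS : S.IsIntermittent αm αp b ε) {i : ℕ}
    (hi : i ∈ Finset.Icc 1 S.m) : closure (S.I i) ⊆ Icc 0 1 :=
  closure_minimal (hS.subset_unit i hi) isClosed_Icc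

theorem left_nonneg (hS : S.IsIntermittent αm αp b ε) {i : ℕ} (hi : i ∈ Finset.Icc 1 S.m) :
    0 ≤ S.left i :=
  (hS.closure_subset_unit hi
    (by rw [hS.closure_I hi]; exact left_mem_Icc.2 (hS.left_lt_right hi).le)).1

theorem right_le_one (hS : S.IsIntermittent αm αp b ε) {i : ℕ} (hi : i ∈ Finset.Icc 1 S.m) :
    S.right i ≤ 1 :=
  (hS.closure_subset_unit hi
    (by rw [hS.closure_I hi]; exact right_mem_Icc.2 (hS.left_lt_right hi).le)).2

theorem left_one (hS : S.IsIntermittent αm αp b ε) : S.left 1 = 0 := by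
  have h := hS.zero_mem
  rw [hS.closure_I hS.one_mem] at h
  exact le_antisymm h.1 (hS.left_nonneg hS.one_mem)

theorem right_one_pos (hS : S.IsIntermittent αm αp b ε) : 0 < S.right 1 :=
  hS.left_one ▸ hS.left_lt_right hS.one_mem

theorem right_one_le_left (hS : S.IsIntermittent αm αp b ε) {i : ℕ} (hi : i ∈ Finset.Icc 2 S.m) :
    S.right 1 ≤ S.left i := by
  have hi1 := mem_Icc_one hi
  by_contra! h
  have hne : (1 : ℕ) ≠ i := by have := (Finset.mem_Icc.1 hi).1; omega
  have hd := hS.disjoint 1 hS.one_mem i hi1 hne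
  have hlt := hS.left_lt_right hi1
  have h0 := hS.left_nonneg hi1
  obtain ⟨x, hx1, hx2⟩ := exists_between (lt_min h hlt)
  rw [lt_min_iff] at hx2
  exact disjoint_left.1 hd (hS.Ioo_subset hS.one_mem ⟨by rw [hS.left_one]; linarith, hx2.1⟩)
    (hS.Ioo_subset hi1 ⟨hx1, hx2.2⟩)

theorem right_one_lt_one (hS : S.IsIntermittent αm αp b ε) : S.right 1 < 1 := by
  have h2 : 2 ∈ Finset.Icc 2 S.m := Finset.mem_Icc.2 ⟨le_rfl, hS.two_le⟩
  exact (hS.right_one_le_left h2).trans_lt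
    ((hS.left_lt_right (mem_Icc_one h2)).trans_le (hS.right_le_one (mem_Icc_one h2)))

theorem closure_subset_Icc (hS : S.IsIntermittent αm αp b ε) {i : ℕ}
    (hi : i ∈ Finset.Icc 2 S.m) : closure (S.I i) ⊆ Icc (S.right 1) 1 := by
  rw [hS.closure_I (mem_Icc_one hi)]
  exact Icc_subset_Icc (hS.right_one_le_left hi) (hS.right_le_one (mem_Icc_one hi))

/-- The inducing domain is the complement of the first interval: as a finite union of closed
intervals it contains the closure of each open set that it fills up to a null set. -/
theorem Y_eq (hS : S.IsIntermittent αm αp b ε) : S.Y = Icc (S.right 1) 1 := by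
  apply Subset.antisymm
  · exact iUnion₂_subset fun i hi => hS.closure_subset_Icc hi
  · have hcl : IsClosed S.Y :=
      Set.Finite.isClosed_biUnion (Finset.Icc 2 S.m).finite_toSet fun i _ => isClosed_closure
    have hopen : IsOpen (Ioo (S.right 1) 1 \ S.Y) := isOpen_Ioo.sdiff hcl
    have hnull : volume (Ioo (S.right 1) 1 \ S.Y) = 0 := by
      refine measure_mono_null ?_ hS.null_compl
      rintro x ⟨hx, hxY⟩
      refine ⟨⟨hS.right_one_pos.le.trans hx.1.le, hx.2.le⟩, fun hxU => hxY ?_⟩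
      obtain ⟨i, hi, hxi⟩ := mem_iUnion₂.1 hxU
      have hxc := subset_closure hxi
      rcases eq_or_ne i 1 with rfl | hne
      · rw [hS.closure_I hi] at hxc
        exact absurd hxc.2 (not_le.2 hx.1)
      · refine mem_iUnion₂.2 ⟨i, ?_, hxc⟩
        have := Finset.mem_Icc.1 hi
        exact Finset.mem_Icc.2 ⟨by omega, this.2⟩
    have hempty := hopen.measure_eq_zero_iff volume |>.1 hnull
    rw [← closure_Ioo hS.right_one_lt_one.ne]
    exact closure_minimal (sdiff_eq_empty.1 hempty) hcl

theorem isCompact_closure (hS : S.IsIntermittent αm αp b ε) {i : ℕ}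
    (hi : i ∈ Finset.Icc 1 S.m) : IsCompact (closure (S.I i)) := by
  rw [hS.closure_I hi]; exact isCompact_Icc

theorem contDiffAt_br (hS : S.IsIntermittent αm αp b ε) {α : ℝ} (hα : α ∈ Icc αm αp) {i : ℕ}
    (hi : i ∈ Finset.Icc 1 S.m) {x : ℝ} (hx : x ∈ closure (S.I i)) :
    ContDiffAt ℝ 1 (S.br α i) x := by
  obtain ⟨W, hW, hsub, -, h1, -⟩ := hS.extends_diffeo α hα i hi
  exact h1.contDiffAt (hW.mem_nhds (hsub hx))

theorem deriv_br_ne_zero (hS : S.IsIntermittent αm αp b ε) {α : ℝ} (hα : α ∈ Icc αm αp) {i : ℕ}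
    (hi : i ∈ Finset.Icc 1 S.m) {x : ℝ} (hx : x ∈ closure (S.I i)) :
    deriv (S.br α i) x ≠ 0 := by
  obtain ⟨W, hW, hsub, -, -, -, h1⟩ := hS.extends_diffeo α hα i hi
  exact h1 x (hsub hx)

theorem hasDerivAt_br (hS : S.IsIntermittent αm αp b ε) {α : ℝ} (hα : α ∈ Icc αm αp) {i : ℕ}
    (hi : i ∈ Finset.Icc 1 S.m) {x : ℝ} (hx : x ∈ closure (S.I i)) :
    HasDerivAt (S.br α i) (deriv (S.br α i) x) x :=
  ((hS.contDiffAt_br hα hi hx).differentiableAt one_ne_zero).hasDerivAt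

theorem continuousOn_br (hS : S.IsIntermittent αm αp b ε) {α : ℝ} (hα : α ∈ Icc αm αp) {i : ℕ}
    (hi : i ∈ Finset.Icc 1 S.m) : ContinuousOn (S.br α i) (closure (S.I i)) :=
  fun _ hx => (hS.hasDerivAt_br hα hi hx).continuousAt.continuousWithinAt

theorem injOn_br (hS : S.IsIntermittent αm αp b ε) {α : ℝ} (hα : α ∈ Icc αm αp) {i : ℕ}
    (hi : i ∈ Finset.Icc 1 S.m) : InjOn (S.br α i) (closure (S.I i)) := by
  obtain ⟨W, hW, hsub, hinj, -⟩ := hS.extends_diffeo α hα i hi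
  exact hinj.mono hsub

theorem image_br (hS : S.IsIntermittent αm αp b ε) {α : ℝ} (hα : α ∈ Icc αm αp) {i : ℕ}
    (hi : i ∈ Finset.Icc 1 S.m) : S.br α i '' closure (S.I i) = Icc 0 1 := by
  rw [image_closure_of_isCompact (hS.isCompact_closure hi) (hS.continuousOn_br hα hi),
    ← hS.full α hα i hi, (hS.eqOn α hα i hi).image_eq]

theorem br_mem (hS : S.IsIntermittent αm αp b ε) {α : ℝ} (hα : α ∈ Icc αm αp) {i : ℕ}
    (hi : i ∈ Finset.Icc 1 S.m) {x : ℝ} (hx : x ∈ closure (S.I i)) :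
    S.br α i x ∈ Icc (0 : ℝ) 1 := hS.image_br hα hi ▸ mem_image_of_mem _ hx

theorem brInv_mem (hS : S.IsIntermittent αm αp b ε) {α : ℝ} (hα : α ∈ Icc αm αp) {i : ℕ}
    (hi : i ∈ Finset.Icc 1 S.m) {y : ℝ} (hy : y ∈ Icc (0 : ℝ) 1) :
    S.brInv α i y ∈ closure (S.I i) :=
  Function.invFunOn_mem (by rw [← hS.image_br hα hi] at hy; exact hy)

theorem br_brInv (hS : S.IsIntermittent αm αp b ε) {α : ℝ} (hα : α ∈ Icc αm αp) {i : ℕ}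
    (hi : i ∈ Finset.Icc 1 S.m) {y : ℝ} (hy : y ∈ Icc (0 : ℝ) 1) :
    S.br α i (S.brInv α i y) = y :=
  Function.invFunOn_eq (by rw [← hS.image_br hα hi] at hy; exact hy)

theorem brInv_br (hS : S.IsIntermittent αm αp b ε) {α : ℝ} (hα : α ∈ Icc αm αp) {i : ℕ}
    (hi : i ∈ Finset.Icc 1 S.m) {x : ℝ} (hx : x ∈ closure (S.I i)) :
    S.brInv α i (S.br α i x) = x :=
  (hS.injOn_br hα hi).leftInvOn_invFunOn hx

/-- The inverse branches are as smooth as the branches, by the inverse function theorem. -/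
theorem contDiffWithinAt_brInv (hS : S.IsIntermittent αm αp b ε) {α : ℝ} (hα : α ∈ Icc αm αp)
    {i : ℕ} (hi : i ∈ Finset.Icc 1 S.m) {y : ℝ} (hy : y ∈ Icc (0 : ℝ) 1) {n : WithTop ℕ∞}
    (hn : n ≠ 0) (hsm : ContDiffAt ℝ n (S.br α i) (S.brInv α i y)) :
    ContDiffWithinAt ℝ n (S.brInv α i) (Icc 0 1) y := by
  have hx := hS.brInv_mem hα hi hy
  have hfx := hS.br_brInv hα hi hy
  obtain ⟨W, hW, hsub, hinj, -⟩ := hS.extends_diffeo α hα i hi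
  set x := S.brInv α i y with hxdef
  -- the local inverse of the extension agrees with `brInv` on `[0,1]` near `y`, since the
  -- extension is injective on `W`
  have hd := (hS.hasDerivAt_br hα hi hx).hasFDerivAt_equiv (hS.deriv_br_ne_zero hα hi hx)
  have hloc := hsm.to_localInverse hd hn
  set g := hsm.localInverse hd hn with hg
  have hgx : g (S.br α i x) = x := by
    exact HasStrictFDerivAt.localInverse_apply_image _
  have hright : ∀ᶠ y' in nhds (S.br α i x), S.br α i (g y') = y' :=
    HasStrictFDerivAt.eventually_right_inverse _
  have hgW : ∀ᶠ y' in nhds (S.br α i x), g y' ∈ W := by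
    have hc := hloc.continuousAt
    apply hc.eventually
    rw [hgx]
    exact hW.mem_nhds (hsub hx)
  rw [hfx] at hloc hright hgW hgx
  refine hloc.contDiffWithinAt.congr_of_eventuallyEq ?_ hgx.symm
  filter_upwards [nhdsWithin_le_nhds hright, nhdsWithin_le_nhds hgW, self_mem_nhdsWithin]
    with y' h1 h2 h3
  exact hinj (hsub (hS.brInv_mem hα hi h3)) h2 (by rw [h1, hS.br_brInv hα hi h3])

theorem hasDerivWithinAt_brInv (hS : S.IsIntermittent αm αp b ε) {α : ℝ} (hα : α ∈ Icc αm αp)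
    {i : ℕ} (hi : i ∈ Finset.Icc 1 S.m) {y : ℝ} (hy : y ∈ Icc (0 : ℝ) 1) :
    HasDerivWithinAt (S.brInv α i) (deriv (S.br α i) (S.brInv α i y))⁻¹ (Icc 0 1) y := by
  have hx := hS.brInv_mem hα hi hy
  have h1 := ((hS.contDiffWithinAt_brInv hα hi hy one_ne_zero
    (hS.contDiffAt_br hα hi hx)).differentiableWithinAt one_ne_zero).hasDerivWithinAt
  have h2 := (hS.hasDerivAt_br hα hi hx).comp_hasDerivWithinAt y h1
  have h3 : HasDerivWithinAt (S.br α i ∘ S.brInv α i) 1 (Icc 0 1) y :=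
    (hasDerivWithinAt_id y _).congr (fun z hz => hS.br_brInv hα hi hz) (hS.br_brInv hα hi hy)
  have h4 := (uniqueDiffOn_Icc zero_lt_one y hy).eq_deriv _ h2 h3
  rw [← eq_inv_of_mul_eq_one_right h4]
  exact h1

end IsIntermittent
end BranchedFamily

/-! ### The first branch near its indifferent fixed point -/

namespace BranchedFamily

/-- The backward orbit `f_{α,1}⁻ⁿ(1)` of the point `1` under the first branch; its points are the
right endpoints of the sets where the orbit needs more than `n` steps to reach `Y`. -/
noncomputable def backOrbit (S : BranchedFamily) (α : ℝ) (n : ℕ) : ℝ := (S.brInv α 1)^[n] 1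

namespace IsIntermittent

variable {S : BranchedFamily} {αm αp : ℝ} {b : ℝ → ℝ} {ε : ℝ}

theorem continuousOn_deriv_br (hS : S.IsIntermittent αm αp b ε) {α : ℝ} (hα : α ∈ Icc αm αp)
    {i : ℕ} (hi : i ∈ Finset.Icc 1 S.m) : ContinuousOn (deriv (S.br α i)) (closure (S.I i)) :=
  (hS.continuous_deriv i hi).comp (f := fun x => (α, x))
    (continuousOn_const.prodMk continuousOn_id) fun _ hx => ⟨hα, hx⟩

/-- The expansion of the branches other than the first persists on the closed intervals. -/
theorem exists_expansion (hS : S.IsIntermittent αm αp b ε) : ∃ σ : ℝ, 1 < σ ∧ ∀ α ∈ Icc αm αp,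
    ∀ i ∈ Finset.Icc 2 S.m, ∀ x ∈ closure (S.I i), σ ≤ |deriv (S.br α i) x| := by
  obtain ⟨σ, hσ, h⟩ := hS.expanding
  exact ⟨σ, hσ, fun α hα i hi x hx => le_on_closure (fun y hy => (h α hα i hi y hy).le)
    continuousOn_const (hS.continuousOn_deriv_br hα (mem_Icc_one hi)).abs hx⟩

theorem one_le_deriv_br_one (hS : S.IsIntermittent αm αp b ε) {α : ℝ} (hα : α ∈ Icc αm αp)
    {x : ℝ} (hx : x ∈ closure (S.I 1)) : 1 ≤ deriv (S.br α 1) x := by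
  have hcl : closure (Ioo (S.left 1) (S.right 1)) = closure (S.I 1) := by
    rw [closure_Ioo (hS.left_lt_right hS.one_mem).ne, hS.closure_I hS.one_mem]
  rw [← hcl] at hx
  refine le_on_closure (f := fun _ => (1 : ℝ)) (fun y hy => (hS.one_lt_deriv α hα y ⟨?_, ?_⟩).le)
    continuousOn_const ?_ hx
  · exact subset_closure (hS.Ioo_subset hS.one_mem hy)
  · rw [hS.left_one] at hy; exact hy.1.ne'
  · rw [hcl]; exact hS.continuousOn_deriv_br hα hS.one_mem

theorem one_le_abs_deriv_br (hS : S.IsIntermittent αm αp b ε) {α : ℝ} (hα : α ∈ Icc αm αp)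
    {i : ℕ} (hi : i ∈ Finset.Icc 1 S.m) {x : ℝ} (hx : x ∈ closure (S.I i)) :
    1 ≤ |deriv (S.br α i) x| := by
  rcases eq_or_ne i 1 with rfl | hne
  · exact (hS.one_le_deriv_br_one hα hx).trans (le_abs_self _)
  · obtain ⟨σ, hσ, h⟩ := hS.exists_expansion
    refine hσ.le.trans (h α hα i ?_ x hx)
    have := Finset.mem_Icc.1 hi
    exact Finset.mem_Icc.2 ⟨by omega, this.2⟩

theorem abs_brInv_sub_le (hS : S.IsIntermittent αm αp b ε) {α : ℝ} (hα : α ∈ Icc αm αp)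
    {i : ℕ} (hi : i ∈ Finset.Icc 1 S.m) {c : ℝ} (hc : 0 < c)
    (h : ∀ x ∈ closure (S.I i), c ≤ |deriv (S.br α i) x|) {x y : ℝ} (hx : x ∈ Icc (0 : ℝ) 1)
    (hy : y ∈ Icc (0 : ℝ) 1) : |S.brInv α i x - S.brInv α i y| ≤ c⁻¹ * |x - y| := by
  have := Convex.norm_image_sub_le_of_norm_hasDerivWithin_le
    (fun z hz => hS.hasDerivWithinAt_brInv hα hi hz) (C := c⁻¹) ?_ (convex_Icc 0 1) hy hx
  · simpa [Real.norm_eq_abs] using this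
  · intro z hz
    rw [norm_inv, Real.norm_eq_abs]
    exact inv_anti₀ hc (h _ (hS.brInv_mem hα hi hz))

theorem closure_I_one (hS : S.IsIntermittent αm αp b ε) :
    closure (S.I 1) = Icc 0 (S.right 1) := by
  rw [hS.closure_I hS.one_mem, hS.left_one]

theorem monotoneOn_br_one_sub (hS : S.IsIntermittent αm αp b ε) {α : ℝ} (hα : α ∈ Icc αm αp) :
    MonotoneOn (fun x => S.br α 1 x - x) (closure (S.I 1)) := by
  rw [hS.closure_I_one]
  have hd : ∀ x ∈ Icc 0 (S.right 1), HasDerivAt (fun x => S.br α 1 x - x)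
      (deriv (S.br α 1) x - 1) x := fun x hx =>
    (hS.hasDerivAt_br hα hS.one_mem (by rwa [hS.closure_I_one])).sub (hasDerivAt_id x)
  refine monotoneOn_of_deriv_nonneg (convex_Icc _ _)
    (fun x hx => (hd x hx).continuousAt.continuousWithinAt)
    (fun x hx => (hd x (interior_subset hx)).differentiableAt.differentiableWithinAt) ?_
  intro x hx
  rw [(hd x (interior_subset hx)).deriv]
  have := hS.one_le_deriv_br_one hα (x := x) (by rw [hS.closure_I_one]; exact interior_subset hx)
  linarith

theorem strictMonoOn_br_one (hS : S.IsIntermittent αm αp b ε) {α : ℝ} (hα : α ∈ Icc αm αp) :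
    StrictMonoOn (S.br α 1) (closure (S.I 1)) := by
  intro x hx y hy hxy
  have : S.br α 1 x - x ≤ S.br α 1 y - y := hS.monotoneOn_br_one_sub hα hx hy hxy.le
  linarith

/-- The expansion of the derivative of the first branch at `0`, integrated. -/
theorem abs_br_one_sub_le (hS : S.IsIntermittent αm αp b ε) (hαm : 0 < αm) :
    ∃ C : ℝ, 0 < C ∧ ∀ α ∈ Icc αm αp, ∀ x ∈ closure (S.I 1),
      |S.br α 1 x - x - b α * x ^ (1 + α)| ≤ C * x ^ (1 + α + ε) := by
  obtain ⟨C, hC, h⟩ := hS.indifferent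
  refine ⟨C, hC, fun α hα x hx => ?_⟩
  have hα0 : 0 < α := hαm.trans_le hα.1
  have hε := hS.ε_pos
  have hd1 : ∀ x ∈ Icc 0 (S.right 1), HasDerivAt (fun x => S.br α 1 x - x - b α * x ^ (1 + α))
      (deriv (S.br α 1) x - 1 - b α * ((1 + α) * x ^ (1 + α - 1))) x := fun x hx =>
    ((hS.hasDerivAt_br hα hS.one_mem (by rwa [hS.closure_I_one])).sub (hasDerivAt_id x)).sub
      ((Real.hasDerivAt_rpow_const (Or.inr (by linarith))).const_mul _)
  have hd2 : ∀ x ∈ Icc 0 (S.right 1), HasDerivAt (fun x => C * x ^ (1 + α + ε))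
      (C * ((1 + α + ε) * x ^ (1 + α + ε - 1))) x := fun x hx =>
    (Real.hasDerivAt_rpow_const (Or.inr (by linarith))).const_mul _
  have hbound : ∀ x ∈ interior (Icc 0 (S.right 1)),
      |deriv (S.br α 1) x - 1 - b α * ((1 + α) * x ^ (1 + α - 1))|
        ≤ C * ((1 + α + ε) * x ^ (1 + α + ε - 1)) := by
    intro x hx
    rw [interior_Icc] at hx
    have h1 := h α hα x (hS.Ioo_subset hS.one_mem (by rwa [hS.left_one]))
    have e : deriv (S.br α 1) x - 1 - b α * ((1 + α) * x ^ (1 + α - 1))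
        = deriv (S.br α 1) x - (1 + b α * (1 + α) * x ^ α) := by
      rw [add_sub_cancel_left]; ring
    have e2 : 1 + α + ε - 1 = α + ε := by ring
    rw [e, e2]
    have hp : 0 < x ^ (α + ε) := Real.rpow_pos_of_pos hx.1 _
    refine h1.trans (mul_le_mul_of_nonneg_left ?_ hC.le)
    nlinarith
  rw [hS.closure_I_one] at hx
  have h0 : (0 : ℝ) ∈ Icc 0 (S.right 1) := left_mem_Icc.2 hS.right_one_pos.le
  have hf0 := hS.fixed_zero α hα
  have hz1 : (0 : ℝ) ^ (1 + α) = 0 := Real.zero_rpow (by linarith)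
  have hz2 : (0 : ℝ) ^ (1 + α + ε) = 0 := Real.zero_rpow (by linarith)
  -- both `C x^(1+α+ε) ∓ (f x - x - b x^(1+α))` vanish at `0` and are monotone
  have m1 : MonotoneOn (fun x => C * x ^ (1 + α + ε) - (S.br α 1 x - x - b α * x ^ (1 + α)))
      (Icc 0 (S.right 1)) := by
    refine monotoneOn_of_deriv_nonneg (convex_Icc _ _)
      (fun x hx => ((hd2 x hx).sub (hd1 x hx)).continuousAt.continuousWithinAt)
      (fun x hx => ((hd2 x (interior_subset hx)).sub
        (hd1 x (interior_subset hx))).differentiableAt.differentiableWithinAt) ?_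
    intro x hx
    have := ((hd2 x (interior_subset hx)).sub (hd1 x (interior_subset hx))).deriv
    erw [this]
    have := (abs_le.1 (hbound x hx)).2
    linarith
  have m2 : MonotoneOn (fun x => C * x ^ (1 + α + ε) + (S.br α 1 x - x - b α * x ^ (1 + α)))
      (Icc 0 (S.right 1)) := by
    refine monotoneOn_of_deriv_nonneg (convex_Icc _ _)
      (fun x hx => ((hd2 x hx).add (hd1 x hx)).continuousAt.continuousWithinAt)
      (fun x hx => ((hd2 x (interior_subset hx)).add
        (hd1 x (interior_subset hx))).differentiableAt.differentiableWithinAt) ?_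
    intro x hx
    have := ((hd2 x (interior_subset hx)).add (hd1 x (interior_subset hx))).deriv
    erw [this]
    have := (abs_le.1 (hbound x hx)).1
    linarith
  have a1 := m1 h0 hx hx.1
  have a2 := m2 h0 hx hx.1
  simp only [hf0, hz1, hz2] at a1 a2
  rw [abs_le]
  constructor <;> linarith

theorem exists_bounds_b (hS : S.IsIntermittent αm αp b ε) (hαp : αm ≤ αp) :
    ∃ bm bM : ℝ, 0 < bm ∧ ∀ α ∈ Icc αm αp, b α ∈ Icc bm bM := by
  have hne : (Icc αm αp).Nonempty := nonempty_Icc.2 hαp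
  obtain ⟨x, hx, hmin⟩ := isCompact_Icc.exists_isMinOn hne hS.b_continuous
  obtain ⟨y, hy, hmax⟩ := isCompact_Icc.exists_isMaxOn hne hS.b_continuous
  exact ⟨b x, b y, hS.b_pos x hx, fun α hα => ⟨hmin hα, hmax hα⟩⟩

/-- The first branch moves points away from the indifferent fixed point at a rate that is uniform
in the parameter. -/
theorem exists_le_br_one_sub (hS : S.IsIntermittent αm αp b ε) (hαm : 0 < αm) (hαp : αm ≤ αp) :
    ∃ δ : ℝ, 0 < δ ∧ δ ≤ 1 ∧ ∀ α ∈ Icc αm αp, ∀ x ∈ closure (S.I 1),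
      δ * x ^ (1 + α) ≤ S.br α 1 x - x := by
  obtain ⟨C, hC, h⟩ := hS.abs_br_one_sub_le hαm
  obtain ⟨bm, bM, hbm, hb⟩ := hS.exists_bounds_b hαp
  have hε := hS.ε_pos
  have ha := hS.right_one_pos
  have ha1 := hS.right_one_lt_one
  -- below `x₀` the error term is at most half of the leading term
  set x₀ := min (S.right 1) ((bm / (2 * C)) ^ (1 / ε)) with hx₀
  have hx₀0 : 0 < x₀ := lt_min ha (by positivity)
  have hx₀a : x₀ ≤ S.right 1 := min_le_left _ _
  have hx₀ε : C * x₀ ^ ε ≤ bm / 2 := by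
    have : x₀ ^ ε ≤ bm / (2 * C) := by
      calc x₀ ^ ε ≤ ((bm / (2 * C)) ^ (1 / ε)) ^ ε :=
            Real.rpow_le_rpow hx₀0.le (min_le_right _ _) hε.le
        _ = bm / (2 * C) := by
            rw [← Real.rpow_mul (by positivity), one_div_mul_cancel hε.ne', Real.rpow_one]
    calc C * x₀ ^ ε ≤ C * (bm / (2 * C)) := by gcongr
      _ = bm / 2 := by field_simp
  have hsmall : ∀ α ∈ Icc αm αp, ∀ x, 0 < x → x ≤ x₀ →
      bm / 2 * x ^ (1 + α) ≤ S.br α 1 x - x := by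
    intro α hα x hx hxx
    have h1 := (abs_le.1 (h α hα x (by rw [hS.closure_I_one]; exact ⟨hx.le, hxx.trans hx₀a⟩))).1
    rw [Real.rpow_add hx (1 + α)] at h1
    have h2 : C * x ^ ε ≤ bm / 2 := le_trans (by gcongr) hx₀ε
    have h3 : 0 < x ^ (1 + α) := by positivity
    have h4 := (hb α hα).1
    nlinarith
  refine ⟨min 1 (bm / 2 * x₀ ^ (1 + αp)), lt_min one_pos (by positivity), min_le_left _ _, ?_⟩
  intro α hα x hx
  have hα0 : 0 < α := hαm.trans_le hα.1
  rw [hS.closure_I_one] at hx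
  have hx1 : x ≤ 1 := hx.2.trans ha1.le
  rcases eq_or_lt_of_le hx.1 with rfl | hx0
  · rw [Real.zero_rpow (by linarith), hS.fixed_zero α hα]; simp
  have hxp : 0 < x ^ (1 + α) := by positivity
  have hx₀1 : x₀ ≤ 1 := hx₀a.trans ha1.le
  rcases le_total x x₀ with hxx | hxx
  · refine le_trans ?_ (hsmall α hα x hx0 hxx)
    gcongr
    refine (min_le_right _ _).trans (mul_le_of_le_one_right (by positivity) ?_)
    exact Real.rpow_le_one hx₀0.le hx₀1 (by linarith [hα.1, hα.2])
  -- beyond `x₀` the displacement `f x - x` is at least its value at `x₀`, by monotonicity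
  · have h1 := hsmall α hα x₀ hx₀0 le_rfl
    have h2 : S.br α 1 x₀ - x₀ ≤ S.br α 1 x - x :=
      hS.monotoneOn_br_one_sub hα (by rw [hS.closure_I_one]; exact ⟨hx₀0.le, hx₀a⟩)
        (by rwa [hS.closure_I_one]) hxx
    refine le_trans ?_ (h1.trans h2)
    calc min 1 (bm / 2 * x₀ ^ (1 + αp)) * x ^ (1 + α) ≤ bm / 2 * x₀ ^ (1 + αp) * 1 :=
          mul_le_mul (min_le_right _ _) (Real.rpow_le_one hx0.le hx1 (by linarith)) hxp.le
            (by positivity)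
      _ ≤ bm / 2 * x₀ ^ (1 + α) := by
          rw [mul_one]
          gcongr bm / 2 * ?_
          exact Real.rpow_le_rpow_of_exponent_ge hx₀0 hx₀1 (by linarith [hα.2])

theorem backOrbit_succ_mem_and (hS : S.IsIntermittent αm αp b ε) {α : ℝ} (hα : α ∈ Icc αm αp)
    (n : ℕ) : S.backOrbit α n ∈ Ioc (0 : ℝ) 1 ∧ S.backOrbit α (n + 1) ∈ closure (S.I 1) ∧
      S.br α 1 (S.backOrbit α (n + 1)) = S.backOrbit α n := by
  have hs : ∀ n, S.backOrbit α (n + 1) = S.brInv α 1 (S.backOrbit α n) := fun n =>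
    Function.iterate_succ_apply' _ _ _
  have key : ∀ n, S.backOrbit α n ∈ Ioc (0 : ℝ) 1 → S.backOrbit α (n + 1) ∈ closure (S.I 1) ∧
      S.br α 1 (S.backOrbit α (n + 1)) = S.backOrbit α n := by
    intro n hn
    rw [hs]
    exact ⟨hS.brInv_mem hα hS.one_mem (Ioc_subset_Icc_self hn),
      hS.br_brInv hα hS.one_mem (Ioc_subset_Icc_self hn)⟩
  have hmem : S.backOrbit α n ∈ Ioc (0 : ℝ) 1 := by
    induction n with
    | zero => simp [backOrbit]
    | succ n ih =>
      obtain ⟨h1, h2⟩ := key n ih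
      have h3 := hS.closure_subset_unit hS.one_mem h1
      refine ⟨lt_of_le_of_ne h3.1 fun h0 => ?_, h3.2⟩
      rw [← h0, hS.fixed_zero α hα] at h2
      exact ih.1.ne h2
  exact ⟨hmem, key n hmem⟩

theorem backOrbit_mem (hS : S.IsIntermittent αm αp b ε) {α : ℝ} (hα : α ∈ Icc αm αp)
    (n : ℕ) : S.backOrbit α n ∈ Ioc (0 : ℝ) 1 := (hS.backOrbit_succ_mem_and hα n).1

theorem backOrbit_succ_mem (hS : S.IsIntermittent αm αp b ε) {α : ℝ} (hα : α ∈ Icc αm αp)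
    (n : ℕ) : S.backOrbit α (n + 1) ∈ closure (S.I 1) := (hS.backOrbit_succ_mem_and hα n).2.1

theorem br_backOrbit_succ (hS : S.IsIntermittent αm αp b ε) {α : ℝ} (hα : α ∈ Icc αm αp)
    (n : ℕ) : S.br α 1 (S.backOrbit α (n + 1)) = S.backOrbit α n :=
  (hS.backOrbit_succ_mem_and hα n).2.2

theorem br_lt_backOrbit_iff (hS : S.IsIntermittent αm αp b ε) {α : ℝ} (hα : α ∈ Icc αm αp)
    (n : ℕ) {y : ℝ} (hy : y ∈ closure (S.I 1)) :
    S.br α 1 y < S.backOrbit α n ↔ y < S.backOrbit α (n + 1) := by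
  rw [← hS.br_backOrbit_succ hα n]
  exact (hS.strictMonoOn_br_one hα).lt_iff_lt hy (hS.backOrbit_succ_mem hα n)

theorem backOrbit_one (hS : S.IsIntermittent αm αp b ε) {α : ℝ} (hα : α ∈ Icc αm αp) :
    S.backOrbit α 1 = S.right 1 := by
  have h1 := hS.backOrbit_succ_mem hα 0
  have hr : S.right 1 ∈ closure (S.I 1) := by
    rw [hS.closure_I_one]; exact right_mem_Icc.2 hS.right_one_pos.le
  refine le_antisymm (by rw [hS.closure_I_one] at h1; exact h1.2) (not_lt.1 fun h => ?_)
  have h2 := hS.strictMonoOn_br_one hα h1 hr h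
  rw [hS.br_backOrbit_succ hα 0] at h2
  exact absurd (hS.br_mem hα hS.one_mem hr).2 (not_le.2 h2)

theorem backOrbit_asymptotics (hS : S.IsIntermittent αm αp b ε) (hαm : 0 < αm) (hαp : αm < αp)
    (hε : ε < αm) : ∃ D : ℝ, 0 < D ∧ ∀ α ∈ Icc αm αp, ∀ n : ℕ, 1 ≤ n →
      S.backOrbit α n ≤ D * (n : ℝ) ^ (-(1 / α)) ∧
      |S.backOrbit α n - (α * b α) ^ (-(1 / α)) * (n : ℝ) ^ (-(1 / α))|
        ≤ D * (n : ℝ) ^ (-((1 + ε) / α)) := by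
  obtain ⟨C, hC, h⟩ := hS.abs_br_one_sub_le hαm
  obtain ⟨bm, bM, hbm, hb⟩ := hS.exists_bounds_b hαp.le
  obtain ⟨δ, hδ, hδ1, hlow⟩ := hS.exists_le_br_one_sub hαm hαp.le
  obtain ⟨D, hD, hmain⟩ := backward_orbit_asymptotics (bM := bM) hαm hαp hbm hS.ε_pos hε hC hδ hδ1
  refine ⟨D, hD, fun α hα => hmain α hα (b α) (hb α hα) (S.backOrbit α) rfl
    (fun n => (hS.backOrbit_mem hα n).1) (fun n => (hS.backOrbit_mem hα n).2) ?_ ?_⟩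
  · intro n
    have := h α hα _ (hS.backOrbit_succ_mem hα n)
    rwa [hS.br_backOrbit_succ hα n] at this
  · intro n
    have := hlow α hα _ (hS.backOrbit_succ_mem hα n)
    rwa [hS.br_backOrbit_succ hα n] at this

end IsIntermittent
end BranchedFamily

/-! ### Distortion and invariant densities -/

/-- The regularity shared by all inverse branches away from the indifferent fixed point: `C³` with
nonvanishing derivative on `(0,1]`, and mapping this interval to itself. Being stable under
composition, it passes to the inverse branches of the first return map. -/
structure IsRegularInverse (u : ℝ → ℝ) : Prop where
  contDiffOn : ContDiffOn ℝ 3 u (Ioc 0 1)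
  mapsTo : MapsTo u (Ioc 0 1) (Ioc 0 1)
  derivWithin_ne_zero : ∀ x ∈ Ioc (0 : ℝ) 1, derivWithin u (Ioc 0 1) x ≠ 0

namespace IsRegularInverse

protected theorem id : IsRegularInverse id where
  contDiffOn := contDiffOn_id
  mapsTo := mapsTo_id _
  derivWithin_ne_zero x hx := by
    rw [derivWithin_id _ _ (uniqueDiffOn_Ioc 0 1 x hx)]; exact one_ne_zero

theorem comp {u v : ℝ → ℝ} (hu : IsRegularInverse u) (hv : IsRegularInverse v) :
    IsRegularInverse (u ∘ v) where
  contDiffOn := hu.contDiffOn.comp hv.contDiffOn hv.mapsTo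
  mapsTo := hu.mapsTo.comp hv.mapsTo
  derivWithin_ne_zero x hx := by
    rw [derivWithin_comp x (hu.contDiffOn.differentiableOn (by norm_num) _ (hv.mapsTo hx))
      (hv.contDiffOn.differentiableOn (by norm_num) _ hx) hv.mapsTo]
    exact mul_ne_zero (hu.derivWithin_ne_zero _ (hv.mapsTo hx)) (hv.derivWithin_ne_zero x hx)

theorem iterate {u : ℝ → ℝ} (hu : IsRegularInverse u) (n : ℕ) : IsRegularInverse u^[n] := by
  induction n with
  | zero => exact IsRegularInverse.id
  | succ n ih => exact ih.comp hu

end IsRegularInverse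

/-- A function whose derivative `g` satisfies `|g'| ≤ K |g|` has bounded distortion. -/
theorem abs_derivWithin_le_exp_mul {u : ℝ → ℝ} {a c K : ℝ} (hac : a < c)
    (hu : ContDiffOn ℝ 2 u (Icc a c)) (h0 : ∀ x ∈ Icc a c, derivWithin u (Icc a c) x ≠ 0)
    (hK : ∀ x ∈ Icc a c, |iteratedDerivWithin 2 u (Icc a c) x| / |derivWithin u (Icc a c) x| ≤ K)
    {x y : ℝ} (hx : x ∈ Icc a c) (hy : y ∈ Icc a c) :
    |derivWithin u (Icc a c) x|
      ≤ Real.exp (K * |x - y|) * |derivWithin u (Icc a c) y| := by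
  set g := derivWithin u (Icc a c) with hg
  have hgd : DifferentiableOn ℝ g (Icc a c) :=
    (hu.derivWithin (m := 1) (uniqueDiffOn_Icc hac) (by norm_num)).differentiableOn one_ne_zero
  have h2 : iteratedDerivWithin 2 u (Icc a c) = derivWithin g (Icc a c) := by
    rw [iteratedDerivWithin_succ, iteratedDerivWithin_one]
  rw [h2] at hK
  have hlog := Convex.norm_image_sub_le_of_norm_hasDerivWithin_le
    (fun z hz => (hgd z hz).hasDerivWithinAt.log (h0 z hz)) (C := K) ?_ (convex_Icc a c) hy hx
  · rw [Real.norm_eq_abs, Real.norm_eq_abs] at hlog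
    have h3 := (abs_le.1 hlog).2
    have hx0 := abs_pos.2 (h0 x hx)
    have hy0 := abs_pos.2 (h0 y hy)
    rw [← Real.log_le_log_iff hx0 (by positivity), Real.log_mul (Real.exp_pos _).ne' hy0.ne',
      Real.log_exp, Real.log_abs, Real.log_abs]
    linarith
  · intro z hz
    rw [norm_div]
    exact hK z hz

namespace BranchedFamily
namespace IsIntermittent

variable {S : BranchedFamily} {αm αp : ℝ} {b : ℝ → ℝ} {ε : ℝ}

theorem isRegularInverse_brInv (hS : S.IsIntermittent αm αp b ε) {α : ℝ} (hα : α ∈ Icc αm αp)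
    {i : ℕ} (hi : i ∈ Finset.Icc 1 S.m) : IsRegularInverse (S.brInv α i) := by
  have hsub : Ioc (0 : ℝ) 1 ⊆ Icc 0 1 := Ioc_subset_Icc_self
  have hne : ∀ y ∈ Ioc (0 : ℝ) 1, ¬ (i = 1 ∧ S.brInv α i y = 0) := by
    rintro y hy ⟨rfl, h0⟩
    have := hS.br_brInv hα hi (hsub hy)
    rw [h0, hS.fixed_zero α hα] at this
    exact hy.1.ne this
  constructor
  · intro y hy
    obtain ⟨W, hW, hWsub, -, -, h3, -⟩ := hS.extends_diffeo α hα i hi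
    refine (hS.contDiffWithinAt_brInv hα hi (hsub hy) (by norm_num) ?_).mono hsub
    refine h3.contDiffAt (IsOpen.mem_nhds ?_ ⟨hWsub (hS.brInv_mem hα hi (hsub hy)), hne y hy⟩)
    refine hW.sdiff (Set.Finite.isClosed ((finite_singleton (0 : ℝ)).subset ?_))
    exact fun x hx => hx.2
  · intro y hy
    have hmem := hS.brInv_mem hα hi (hsub hy)
    have h01 := hS.closure_subset_unit hi hmem
    refine ⟨lt_of_le_of_ne h01.1 fun h0 => ?_, h01.2⟩
    rcases eq_or_ne i 1 with rfl | hi1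
    · exact hne y hy ⟨rfl, h0.symm⟩
    · have hi2 : i ∈ Finset.Icc 2 S.m := by
        have := Finset.mem_Icc.1 hi
        exact Finset.mem_Icc.2 ⟨by omega, this.2⟩
      have := (hS.closure_subset_Icc hi2 hmem).1
      rw [← h0] at this
      exact absurd hS.right_one_pos (not_lt.2 this)
  · intro y hy
    rw [((hS.hasDerivWithinAt_brInv hα hi (hsub hy)).mono hsub).derivWithin
      (uniqueDiffOn_Ioc 0 1 y hy)]
    exact inv_ne_zero (hS.deriv_br_ne_zero hα hi (hS.brInv_mem hα hi (hsub hy)))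

theorem isRegularInverse_indInv (hS : S.IsIntermittent αm αp b ε) {α : ℝ} (hα : α ∈ Icc αm αp)
    {i : ℕ} (hi : i ∈ Finset.Icc 2 S.m) (k : ℕ) : IsRegularInverse (S.indInv α i k) :=
  (hS.isRegularInverse_brInv hα (mem_Icc_one hi)).comp
    ((hS.isRegularInverse_brInv hα hS.one_mem).iterate _)

/-- The iterated inverse of the first branch maps `[0,1]` into itself and does not increase
distances. -/
theorem brInv_one_iterate (hS : S.IsIntermittent αm αp b ε) {α : ℝ} (hα : α ∈ Icc αm αp) (n : ℕ)
    {x y : ℝ} (hx : x ∈ Icc (0 : ℝ) 1) (hy : y ∈ Icc (0 : ℝ) 1) :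
    (S.brInv α 1)^[n] x ∈ Icc (0 : ℝ) 1 ∧
      |(S.brInv α 1)^[n] x - (S.brInv α 1)^[n] y| ≤ |x - y| := by
  induction n generalizing x y with
  | zero => exact ⟨hx, le_rfl⟩
  | succ n ih =>
    have hm : ∀ {x}, x ∈ Icc (0 : ℝ) 1 → S.brInv α 1 x ∈ Icc (0 : ℝ) 1 := fun h =>
      hS.closure_subset_unit hS.one_mem (hS.brInv_mem hα hS.one_mem h)
    obtain ⟨h1, h2⟩ := ih (hm hx) (hm hy)
    refine ⟨h1, h2.trans ?_⟩
    have := hS.abs_brInv_sub_le hα hS.one_mem one_pos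
      (fun z hz => hS.one_le_abs_deriv_br hα hS.one_mem hz) hx hy
    simpa using this

theorem indInv_mem_Y (hS : S.IsIntermittent αm αp b ε) {α : ℝ} (hα : α ∈ Icc αm αp) {i : ℕ}
    (hi : i ∈ Finset.Icc 2 S.m) (k : ℕ) {x : ℝ} (hx : x ∈ Icc (0 : ℝ) 1) :
    S.indInv α i k x ∈ S.Y :=
  mem_iUnion₂.2 ⟨i, hi, hS.brInv_mem hα (mem_Icc_one hi) (hS.brInv_one_iterate hα _ hx hx).1⟩

theorem Y_subset_Ioc (hS : S.IsIntermittent αm αp b ε) : S.Y ⊆ Ioc 0 1 := by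
  rw [hS.Y_eq]
  exact fun x hx => ⟨hS.right_one_pos.trans_le hx.1, hx.2⟩

/-- The branches of the first return map have distortion bounded by `K`. -/
theorem G_one_le_exp_mul (hS : S.IsIntermittent αm αp b ε) {α K : ℝ} (hα : α ∈ Icc αm αp) {i k : ℕ}
    (hi : i ∈ Finset.Icc 2 S.m) (hK : ∀ x ∈ S.Y, S.G 2 α i k x / S.G 1 α i k x ≤ K)
    {x y : ℝ} (hx : x ∈ S.Y) (hy : y ∈ S.Y) :
    S.G 1 α i k x ≤ Real.exp (K * |x - y|) * S.G 1 α i k y := by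
  have hu := hS.isRegularInverse_indInv hα hi k
  have hsub := hS.Y_subset_Ioc
  simp only [G, iteratedDerivWithin_one] at hK ⊢
  rw [hS.Y_eq] at hK hx hy hsub ⊢
  refine abs_derivWithin_le_exp_mul hS.right_one_lt_one
    ((hu.contDiffOn.mono hsub).of_le (by norm_num)) (fun z hz => ?_) hK hx hy
  rw [derivWithin_subset hsub (uniqueDiffOn_Icc hS.right_one_lt_one z hz)
    (hu.contDiffOn.differentiableOn (by norm_num) _ (hsub hz))]
  exact hu.derivWithin_ne_zero z (hsub hz)

/-- The bound on `∑ ‖G‖ γ` with `γ ≥ 1` makes the series in the Ruelle operator converge, so that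
its `∑'` is not a junk value. -/
theorem summable_G_one (hS : S.IsIntermittent αm αp b ε) {α : ℝ} (hα : α ∈ Icc αm αp) {i : ℕ}
    (hi : i ∈ Finset.Icc 2 S.m) {x : ℝ} (hx : x ∈ S.Y) :
    Summable fun k : ℕ => S.G 1 α i (k + 1) x := by
  obtain ⟨K, -, γ, hγ, -, hsum⟩ := hS.induced
  have h1 : ∑' k : ℕ, ENNReal.ofReal (S.G 1 α i (k + 1) x) ≠ ⊤ := by
    refine ne_top_of_le_ne_top (ENNReal.ofReal_ne_top (r := K)) (le_trans ?_ (hsum α hα))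
    refine le_trans ?_ (Finset.single_le_sum (fun _ _ => zero_le) hi)
    refine ENNReal.tsum_le_tsum fun k => ?_
    have h2 : ENNReal.ofReal (S.G 1 α i (k + 1) x)
        ≤ ⨆ x ∈ S.Y, ENNReal.ofReal (S.G 1 α i (k + 1) x) :=
      le_iSup₂ (f := fun x (_ : x ∈ S.Y) => ENNReal.ofReal (S.G 1 α i (k + 1) x)) x hx
    refine h2.trans (le_mul_of_one_le_right zero_le ?_)
    rw [ENNReal.one_le_ofReal]
    exact hγ i hi (k + 1) (by omega)
  refine (ENNReal.summable_toReal h1).congr fun k => ?_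
  exact ENNReal.toReal_ofReal (abs_nonneg _)

/-- Invariance under the Ruelle operator improves the regularity of a density: a logarithmic
Lipschitz constant `L` may be replaced by `K + σ⁻¹ L`. -/
theorem ruelle_distortion_step (hS : S.IsIntermittent αm αp b ε) {α K σ L M : ℝ}
    (hα : α ∈ Icc αm αp) (hσ : 0 < σ)
    (hK : ∀ i ∈ Finset.Icc 2 S.m, ∀ k, 1 ≤ k → ∀ x ∈ S.Y, S.G 2 α i k x / S.G 1 α i k x ≤ K)
    (hexp : ∀ i ∈ Finset.Icc 2 S.m, ∀ x ∈ closure (S.I i), σ ≤ |deriv (S.br α i) x|)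
    {h : ℝ → ℝ} (hfix : ∀ x ∈ S.Y, S.ruelle α h x = h x)
    (hpos : ∀ x ∈ S.Y, 0 ≤ h x) (hM : ∀ x ∈ S.Y, h x ≤ M) (hL0 : 0 ≤ L)
    (hL : ∀ x ∈ S.Y, ∀ y ∈ S.Y, h x ≤ Real.exp (L * |x - y|) * h y)
    {x y : ℝ} (hx : x ∈ S.Y) (hy : y ∈ S.Y) :
    h x ≤ Real.exp ((K + σ⁻¹ * L) * |x - y|) * h y := by
  have h01 : S.Y ⊆ Icc 0 1 := hS.Y_subset_Ioc.trans Ioc_subset_Icc_self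
  have hsum : ∀ i ∈ Finset.Icc 2 S.m, ∀ x ∈ S.Y,
      Summable fun k : ℕ => S.G 1 α i (k + 1) x * h (S.indInv α i (k + 1) x) := by
    intro i hi x hx
    refine Summable.of_nonneg_of_le
      (fun k => mul_nonneg (abs_nonneg _) (hpos _ (hS.indInv_mem_Y hα hi _ (h01 hx))))
      (fun k => mul_le_mul_of_nonneg_left (hM _ (hS.indInv_mem_Y hα hi _ (h01 hx))) (abs_nonneg _))
      ((hS.summable_G_one hα hi hx).mul_right M)
  rw [← hfix x hx, ← hfix y hy, ruelle, ruelle, Finset.mul_sum]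
  refine Finset.sum_le_sum fun i hi => ?_
  rw [← tsum_mul_left]
  refine (hsum i hi x hx).tsum_le_tsum (fun k => ?_) ((hsum i hi y hy).mul_left _)
  have hux := hS.indInv_mem_Y hα hi (k + 1) (h01 hx)
  have huy := hS.indInv_mem_Y hα hi (k + 1) (h01 hy)
  have hcontr : |S.indInv α i (k + 1) x - S.indInv α i (k + 1) y| ≤ σ⁻¹ * |x - y| := by
    obtain ⟨hx', hd⟩ := hS.brInv_one_iterate hα k (h01 hx) (h01 hy)
    have hy' := (hS.brInv_one_iterate hα k (h01 hy) (h01 hy)).1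
    refine (hS.abs_brInv_sub_le hα (mem_Icc_one hi) hσ (hexp i hi) hx' hy').trans ?_
    gcongr
  have hG := hS.G_one_le_exp_mul hα hi (hK i hi (k + 1) (by omega)) hx hy
  have hh : h (S.indInv α i (k + 1) x)
      ≤ Real.exp (σ⁻¹ * L * |x - y|) * h (S.indInv α i (k + 1) y) := by
    refine (hL _ hux _ huy).trans (mul_le_mul_of_nonneg_right ?_ (hpos _ huy))
    apply Real.exp_le_exp.2
    calc L * |S.indInv α i (k + 1) x - S.indInv α i (k + 1) y| ≤ L * (σ⁻¹ * |x - y|) := by gcongr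
      _ = _ := by ring
  refine (mul_le_mul hG hh (hpos _ hux) (mul_nonneg (Real.exp_pos _).le (abs_nonneg _))).trans_eq ?_
  rw [add_mul, Real.exp_add]; ring

theorem volume_Y (hS : S.IsIntermittent αm αp b ε) :
    volume S.Y = ENNReal.ofReal (1 - S.right 1) := by
  rw [hS.Y_eq, Real.volume_Icc]

theorem inducedMeasure_apply (h : ℝ → ℝ) {A : Set ℝ} (hA : MeasurableSet A) (hAY : A ⊆ S.Y) :
    S.inducedMeasure h A = (volume S.Y)⁻¹ * ∫⁻ x in A, ENNReal.ofReal (h x) := by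
  rw [inducedMeasure, withDensity_apply _ hA, Measure.restrict_smul, lintegral_smul_measure,
    Measure.restrict_restrict hA, inter_eq_left.2 hAY, smul_eq_mul]

/-- The logarithmic Lipschitz constant of the invariant density is bounded uniformly in the
parameter. -/
theorem exists_density_distortion (hS : S.IsIntermittent αm αp b ε) :
    ∃ L : ℝ, 0 < L ∧ ∀ α ∈ Icc αm αp, ∀ h : ℝ → ℝ, S.IsInvariantDensity α h →
      ∀ x ∈ S.Y, ∀ y ∈ S.Y, h x ≤ Real.exp (L * |x - y|) * h y := by
  obtain ⟨K, hK0, γ, -, hK, -⟩ := hS.induced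
  obtain ⟨σ, hσ, hexp⟩ := hS.exists_expansion
  have hσ0 : 0 < σ := by linarith
  have hθ1 : σ⁻¹ < 1 := inv_lt_one_of_one_lt₀ hσ
  have hθ0 : 0 < σ⁻¹ := by positivity
  have h1θ : 0 < 1 - σ⁻¹ := by linarith
  refine ⟨K / (1 - σ⁻¹), by positivity, fun α hα h hh => ?_⟩
  obtain ⟨D, hD1, hD⟩ := hh.bounds
  have hD0 : 0 < D := by linarith
  have hpos : ∀ x ∈ S.Y, 0 < h x := fun x hx => lt_of_lt_of_le (by positivity) (hD x hx).1
  obtain ⟨M, hM⟩ := hh.contDiffOn.exists_lipschitzOnWith two_ne_zero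
    (by rw [hS.Y_eq]; exact convex_Icc _ _) (by rw [hS.Y_eq]; exact isCompact_Icc)
  -- a first logarithmic Lipschitz constant, which depends on `h`
  have hstart : ∀ x ∈ S.Y, ∀ y ∈ S.Y, h x ≤ Real.exp (M * D * |x - y|) * h y := by
    intro x hx y hy
    have h1 := hM.dist_le_mul x hx y hy
    rw [Real.dist_eq, Real.dist_eq] at h1
    have h2 := (abs_le.1 h1).2
    have h3 : 1 ≤ D * h y := by
      have := (hD y hy).1
      rw [inv_le_iff_one_le_mul₀ hD0] at this
      linarith
    have h4 := Real.add_one_le_exp (M * D * |x - y|)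
    have h5 : (M : ℝ) * |x - y| ≤ M * |x - y| * (D * h y) :=
      le_mul_of_one_le_right (by positivity) h3
    nlinarith [mul_le_mul_of_nonneg_right h4 (hpos y hy).le]
  -- iterating the improvement makes the dependence on `h` decay geometrically
  have hiter : ∀ n : ℕ, ∀ x ∈ S.Y, ∀ y ∈ S.Y,
      h x ≤ Real.exp ((K / (1 - σ⁻¹) + σ⁻¹ ^ n * (M * D)) * |x - y|) * h y := by
    intro n
    induction n with
    | zero =>
      intro x hx y hy
      refine (hstart x hx y hy).trans (mul_le_mul_of_nonneg_right ?_ (hpos y hy).le)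
      apply Real.exp_le_exp.2
      refine mul_le_mul_of_nonneg_right ?_ (abs_nonneg _)
      rw [pow_zero, one_mul]
      exact le_add_of_nonneg_left (by positivity)
    | succ n ih =>
      intro x hx y hy
      have := hS.ruelle_distortion_step hα hσ0 (fun i hi k hk x hx => (hK α hα i hi k hk x hx).1)
        (hexp α hα) hh.fixed (fun x hx => (hpos x hx).le) (fun x hx => (hD x hx).2)
        (by positivity) ih hx hy
      have e : K + σ⁻¹ * (K / (1 - σ⁻¹) + σ⁻¹ ^ n * (M * D))
          = K / (1 - σ⁻¹) + σ⁻¹ ^ (n + 1) * (M * D) := by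
        have : K / (1 - σ⁻¹) = K + σ⁻¹ * (K / (1 - σ⁻¹)) := by
          generalize σ⁻¹ = θ at *
          field_simp; ring
        rw [mul_add, ← add_assoc, ← this, pow_succ]; ring
      rwa [e] at this
  intro x hx y hy
  have hlim : Filter.Tendsto
      (fun n : ℕ => Real.exp ((K / (1 - σ⁻¹) + σ⁻¹ ^ n * (M * D)) * |x - y|) * h y) Filter.atTop
      (nhds (Real.exp ((K / (1 - σ⁻¹) + 0 * (M * D)) * |x - y|) * h y)) := by
    refine Filter.Tendsto.mul_const _ ?_
    refine (Real.continuous_exp.tendsto _).comp ?_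
    exact (((tendsto_pow_atTop_nhds_zero_of_lt_one hθ0.le hθ1).mul_const _).const_add _).mul_const _
  rw [zero_mul, add_zero] at hlim
  exact ge_of_tendsto' hlim fun n => hiter n x hx y hy

/-- The invariant densities are uniformly bounded, because they have mass one and bounded
distortion, and hence uniformly Lipschitz. -/
theorem exists_density_bounds (hS : S.IsIntermittent αm αp b ε) :
    ∃ M : ℝ, 0 < M ∧ ∀ α ∈ Icc αm αp, ∀ h : ℝ → ℝ, S.IsInvariantDensity α h →
      (∀ x ∈ S.Y, 0 < h x ∧ h x ≤ M) ∧ ∀ x ∈ S.Y, ∀ y ∈ S.Y, |h x - h y| ≤ M * |x - y| := by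
  obtain ⟨L, hL0, hL⟩ := hS.exists_density_distortion
  have hdist : ∀ x ∈ S.Y, ∀ y ∈ S.Y, |x - y| ≤ 1 := by
    intro x hx y hy
    have h1 := hS.Y_subset_Ioc hx
    have h2 := hS.Y_subset_Ioc hy
    rw [abs_le]; constructor <;> linarith [h1.1, h1.2, h2.1, h2.2]
  refine ⟨Real.exp L * (1 + L * Real.exp L), by positivity, fun α hα h hh => ?_⟩
  have hpos : ∀ x ∈ S.Y, 0 < h x := by
    obtain ⟨D, hD1, hD⟩ := hh.bounds
    exact fun x hx => lt_of_lt_of_le (by positivity) (hD x hx).1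
  have hle : ∀ x ∈ S.Y, h x ≤ Real.exp L := by
    intro x hx
    have hlow : ∀ y ∈ S.Y, Real.exp (-L) * h x ≤ h y := by
      intro y hy
      have h1 : h x ≤ Real.exp L * h y := (hL α hα h hh x hx y hy).trans
        (mul_le_mul_of_nonneg_right
          (Real.exp_le_exp.2 (mul_le_of_le_one_right hL0.le (hdist x hx y hy))) (hpos y hy).le)
      calc Real.exp (-L) * h x ≤ Real.exp (-L) * (Real.exp L * h y) := by gcongr
        _ = h y := by rw [← mul_assoc, ← Real.exp_add]; simp
    have hYm : MeasurableSet S.Y := by rw [hS.Y_eq]; exact measurableSet_Icc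
    have hmass := hh.mass
    rw [inducedMeasure_apply h hYm Subset.rfl] at hmass
    have h2 : ENNReal.ofReal (Real.exp (-L) * h x) * volume S.Y
        ≤ ∫⁻ y in S.Y, ENNReal.ofReal (h y) := by
      rw [← setLIntegral_const]
      exact setLIntegral_mono_ae' hYm (Filter.Eventually.of_forall fun y hy =>
        ENNReal.ofReal_le_ofReal (hlow y hy))
    have hY0 : volume S.Y ≠ 0 := by
      rw [hS.volume_Y, ne_eq, ENNReal.ofReal_eq_zero, not_le, sub_pos]
      exact hS.right_one_lt_one
    have hYt : volume S.Y ≠ ⊤ := by rw [hS.volume_Y]; exact ENNReal.ofReal_ne_top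
    have h3 : ENNReal.ofReal (Real.exp (-L) * h x) ≤ 1 := by
      rw [← hmass, mul_comm (volume S.Y)⁻¹, ← div_eq_mul_inv]
      rwa [ENNReal.le_div_iff_mul_le (Or.inl hY0) (Or.inl hYt)]
    rw [ENNReal.ofReal_le_one, Real.exp_neg, inv_mul_le_iff₀ (Real.exp_pos L), mul_one] at h3
    exact h3
  have hone : ∀ x ∈ S.Y, ∀ y ∈ S.Y, h x - h y
      ≤ Real.exp L * (1 + L * Real.exp L) * |x - y| := by
    intro x hx y hy
    have h1 := hL α hα h hh x hx y hy
    set t := L * |x - y| with ht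
    have ht0 : 0 ≤ t := by positivity
    have htL : t ≤ L := mul_le_of_le_one_right hL0.le (hdist x hx y hy)
    have h2 : Real.exp t - 1 ≤ t * Real.exp L := by
      have h3 : Real.exp t * (1 - t) ≤ 1 := by
        calc Real.exp t * (1 - t) ≤ Real.exp t * Real.exp (-t) := by
              gcongr; exact Real.one_sub_le_exp_neg t
          _ = 1 := by rw [← Real.exp_add]; simp
      have h4 : t * Real.exp t ≤ t * Real.exp L := by gcongr
      linarith
    calc h x - h y ≤ (Real.exp t - 1) * h y := by linarith
      _ ≤ (t * Real.exp L) * Real.exp L :=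
          mul_le_mul h2 (hle y hy) (hpos y hy).le (by positivity)
      _ ≤ _ := by
          rw [ht]
          nlinarith [mul_nonneg (Real.exp_pos L).le (abs_nonneg (x - y))]
  refine ⟨fun x hx => ⟨hpos x hx, (hle x hx).trans (le_mul_of_one_le_right (Real.exp_pos L).le
    (by have := mul_pos hL0 (Real.exp_pos L); linarith))⟩, fun x hx y hy => ?_⟩
  rw [abs_le]
  have h1 := hone x hx y hy
  have h2 := hone y hy x hx
  rw [abs_sub_comm y x] at h2
  constructor <;> linarith

end IsIntermittent
end BranchedFamily

/-! ### Return times and the tail sets -/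

namespace BranchedFamily

/-- The points of `Y` with return time larger than `n`. -/
def tailSet (S : BranchedFamily) (α : ℝ) (n : ℕ) : Set ℝ :=
  {x | x ∈ S.Y ∧ (n : ℕ∞) < S.returnTime α x}

/-- The points of `closure (I i)` that the `i`-th branch maps to the left of `z`. -/
def belowSet (S : BranchedFamily) (α : ℝ) (i : ℕ) (z : ℝ) : Set ℝ :=
  closure (S.I i) ∩ S.br α i ⁻¹' Iio z

/-- The finite set of points of `Y` whose itinerary is not governed by the extended branches: the
endpoints of the intervals, where `f α` and the extended branches may differ, and the preimages of
the indifferent fixed point. -/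
def exceptionalSet (S : BranchedFamily) (α : ℝ) : Set ℝ :=
  ⋃ i ∈ Finset.Icc 2 S.m, {S.left i, S.right i, S.brInv α i 0}

theorem finite_exceptionalSet (S : BranchedFamily) (α : ℝ) : (S.exceptionalSet α).Finite :=
  (Finset.Icc 2 S.m).finite_toSet.biUnion fun _ _ => by simp

theorem lt_returnTime_iff (S : BranchedFamily) (α x : ℝ) (n : ℕ) :
    (n : ℕ∞) < S.returnTime α x ↔ ∀ k, 1 ≤ k → k ≤ n → (S.f α)^[k] x ∉ S.Y := by
  rw [← ENat.add_one_le_iff (ENat.natCast_ne_top n), returnTime, le_sInf_iff]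
  constructor
  · intro h k hk hkn hkY
    have := h k ⟨k, ⟨hk, hkY⟩, rfl⟩
    have : n + 1 ≤ k := by exact_mod_cast this
    omega
  · rintro h _ ⟨k, ⟨hk, hkY⟩, rfl⟩
    have : n + 1 ≤ k := by
      by_contra! hlt
      exact h k hk (by omega) hkY
    simp only
    exact_mod_cast this

theorem tailSet_zero (S : BranchedFamily) (α : ℝ) : S.tailSet α 0 = S.Y := by
  ext x
  rw [tailSet, mem_ofPred_eq, lt_returnTime_iff]
  exact and_iff_left fun k hk hk0 => by omega

theorem returnTime_eq_succ_iff (S : BranchedFamily) (α : ℝ) (n : ℕ) :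
    {x | x ∈ S.Y ∧ S.returnTime α x = ((n + 1 : ℕ) : ℕ∞)}
      = S.tailSet α n \ S.tailSet α (n + 1) := by
  ext x
  simp only [tailSet, mem_ofPred_eq, mem_sdiff, not_and, not_lt]
  rw [← ENat.add_one_le_iff (ENat.natCast_ne_top n)]
  push_cast
  constructor
  · rintro ⟨hx, h⟩
    exact ⟨⟨hx, h.ge⟩, fun _ => h.le⟩
  · rintro ⟨⟨hx, h1⟩, h2⟩
    exact ⟨hx, le_antisymm (h2 hx) h1⟩

namespace IsIntermittent

variable {S : BranchedFamily} {αm αp : ℝ} {b : ℝ → ℝ} {ε : ℝ}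

theorem measurableSet_Y (hS : S.IsIntermittent αm αp b ε) : MeasurableSet S.Y := by
  rw [hS.Y_eq]; exact measurableSet_Icc

theorem not_mem_Y_iff (hS : S.IsIntermittent αm αp b ε) {α : ℝ} (hα : α ∈ Icc αm αp) {y : ℝ}
    (hy : y ≤ 1) : y ∉ S.Y ↔ y < S.backOrbit α 1 := by
  rw [hS.backOrbit_one hα, hS.Y_eq, mem_Icc, not_and, ← not_le]
  exact ⟨fun h h1 => h h1 hy, fun h h1 => absurd h1 h⟩

/-- An orbit starting at `y > 0` stays out of `Y` for `n + 1` steps exactly when `y` lies to the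
left of the `n + 1`st point of the backward orbit of `1`. -/
theorem orbit_avoids_Y_iff (hS : S.IsIntermittent αm αp b ε) {α : ℝ} (hα : α ∈ Icc αm αp) (n : ℕ)
    {y : ℝ} (hy : y ∈ Ioc (0 : ℝ) 1) :
    (∀ k, k < n + 1 → (S.f α)^[k] y ∉ S.Y) ↔ y < S.backOrbit α (n + 1) := by
  induction n generalizing y with
  | zero =>
    rw [← hS.not_mem_Y_iff hα hy.2]
    refine ⟨fun h => h 0 one_pos, fun h k hk => ?_⟩
    obtain rfl : k = 0 := by omega
    exact h
  | succ n ih =>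
    have hsplit : (∀ k, k < n + 1 + 1 → (S.f α)^[k] y ∉ S.Y)
        ↔ y ∉ S.Y ∧ ∀ k, k < n + 1 → (S.f α)^[k] (S.f α y) ∉ S.Y := by
      constructor
      · exact fun h => ⟨h 0 (by omega), fun k hk => h (k + 1) (by omega)⟩
      · rintro ⟨h0, h⟩ k hk
        cases k with
        | zero => exact h0
        | succ k => exact h k (by omega)
    rw [hsplit]
    by_cases hyY : y ∈ S.Y
    · refine iff_of_false (fun h => h.1 hyY) (not_lt.2 ?_)
      have h1 := hS.backOrbit_succ_mem hα (n + 1)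
      rw [hS.closure_I_one] at h1
      rw [hS.Y_eq] at hyY
      exact h1.2.trans hyY.1
    · have hya := (hS.not_mem_Y_iff hα hy.2).1 hyY
      rw [hS.backOrbit_one hα] at hya
      have hyI : y ∈ S.I 1 := hS.Ioo_subset hS.one_mem ⟨by rw [hS.left_one]; exact hy.1, hya⟩
      have hyc := subset_closure hyI
      have hfy := hS.eqOn α hα 1 hS.one_mem hyI
      have hpos : 0 < S.br α 1 y := by
        have := hS.strictMonoOn_br_one hα hS.zero_mem hyc hy.1
        rwa [hS.fixed_zero α hα] at this
      rw [hfy, ih ⟨hpos, (hS.br_mem hα hS.one_mem hyc).2⟩, hS.br_lt_backOrbit_iff hα _ hyc]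
      exact and_iff_right hyY

theorem mem_tailSet_succ_iff (hS : S.IsIntermittent αm αp b ε) {α : ℝ} (hα : α ∈ Icc αm αp)
    (n : ℕ) {i : ℕ} (hi : i ∈ Finset.Icc 2 S.m) {x : ℝ} (hx : x ∈ S.I i)
    (hxe : x ∉ S.exceptionalSet α) :
    x ∈ S.tailSet α (n + 1) ↔ S.br α i x < S.backOrbit α (n + 1) := by
  have hi1 := mem_Icc_one hi
  have hxc := subset_closure hx
  have hxY : x ∈ S.Y := mem_iUnion₂.2 ⟨i, hi, hxc⟩
  have hpos : 0 < S.br α i x := by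
    refine lt_of_le_of_ne (hS.br_mem hα hi1 hxc).1 fun h0 => hxe ?_
    refine mem_iUnion₂.2 ⟨i, hi, Or.inr (Or.inr ?_)⟩
    rw [mem_singleton_iff, h0, hS.brInv_br hα hi1 hxc]
  rw [← hS.orbit_avoids_Y_iff hα n ⟨hpos, (hS.br_mem hα hi1 hxc).2⟩, tailSet, mem_ofPred_eq,
    lt_returnTime_iff, and_iff_right hxY, ← hS.eqOn α hα i hi1 hx]
  constructor
  · exact fun h k hk => h (k + 1) (by omega) (by omega)
  · intro h k hk hkn
    obtain ⟨k, rfl⟩ := Nat.exists_eq_add_of_le' hk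
    exact h k (by omega)

theorem exists_mem_I (hS : S.IsIntermittent αm αp b ε) {α : ℝ} {x : ℝ} (hx : x ∈ S.Y)
    (hxe : x ∉ S.exceptionalSet α) : ∃ i ∈ Finset.Icc 2 S.m, x ∈ S.I i := by
  obtain ⟨i, hi, hxi⟩ := mem_iUnion₂.1 hx
  refine ⟨i, hi, hS.Ioo_subset (mem_Icc_one hi) ?_⟩
  rw [hS.closure_I (mem_Icc_one hi)] at hxi
  refine ⟨lt_of_le_of_ne hxi.1 fun h => hxe ?_, lt_of_le_of_ne hxi.2 fun h => hxe ?_⟩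
  · exact mem_iUnion₂.2 ⟨i, hi, Or.inl h.symm⟩
  · exact mem_iUnion₂.2 ⟨i, hi, Or.inr (Or.inl h)⟩

/-- Up to finitely many points, the return time of a point of `I i` exceeds `n + 1` if and only if
its image lies to the left of the `n + 1`st point of the backward orbit of `1`. -/
theorem tailSet_succ_diff (hS : S.IsIntermittent αm αp b ε) {α : ℝ} (hα : α ∈ Icc αm αp) (n : ℕ) :
    S.tailSet α (n + 1) \ S.exceptionalSet α
      = (⋃ i ∈ Finset.Icc 2 S.m, S.I i ∩ S.belowSet α i (S.backOrbit α (n + 1)))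
          \ S.exceptionalSet α := by
  ext x
  constructor
  · rintro ⟨hx, hxe⟩
    obtain ⟨i, hi, hxi⟩ := hS.exists_mem_I hx.1 hxe
    exact ⟨mem_iUnion₂.2 ⟨i, hi, hxi, subset_closure hxi,
      (hS.mem_tailSet_succ_iff hα n hi hxi hxe).1 hx⟩, hxe⟩
  · rintro ⟨hx, hxe⟩
    obtain ⟨i, hi, hxi, -, hlt⟩ := mem_iUnion₂.1 hx
    exact ⟨(hS.mem_tailSet_succ_iff hα n hi hxi hxe).2 hlt, hxe⟩

theorem measurableSet_belowSet (hS : S.IsIntermittent αm αp b ε) {α : ℝ} (hα : α ∈ Icc αm αp)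
    {i : ℕ} (hi : i ∈ Finset.Icc 1 S.m) (z : ℝ) : MeasurableSet (S.belowSet α i z) := by
  obtain ⟨u, hu, hu'⟩ := (continuousOn_iff'.1 (hS.continuousOn_br hα hi)) _ (isOpen_Iio (a := z))
  rw [belowSet, inter_comm, hu']
  exact hu.measurableSet.inter isClosed_closure.measurableSet

theorem measurableSet_I_inter_belowSet (hS : S.IsIntermittent αm αp b ε) {α : ℝ}
    (hα : α ∈ Icc αm αp) {i : ℕ} (hi : i ∈ Finset.Icc 1 S.m) (z : ℝ) :
    MeasurableSet (S.I i ∩ S.belowSet α i z) :=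
  (hS.ordConnected i hi).measurableSet.inter (hS.measurableSet_belowSet hα hi z)

theorem measurableSet_tailSet (hS : S.IsIntermittent αm αp b ε) {α : ℝ} (hα : α ∈ Icc αm αp)
    (n : ℕ) : MeasurableSet (S.tailSet α n) := by
  cases n with
  | zero => rw [tailSet_zero]; exact hS.measurableSet_Y
  | succ n =>
    rw [← sdiff_union_inter (S.tailSet α (n + 1)) (S.exceptionalSet α), hS.tailSet_succ_diff hα]
    refine MeasurableSet.union (MeasurableSet.diff (Finset.measurableSet_biUnion _ fun i hi =>
      hS.measurableSet_I_inter_belowSet hα (mem_Icc_one hi) _)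
      (S.finite_exceptionalSet α).measurableSet) ?_
    exact ((S.finite_exceptionalSet α).subset inter_subset_right).measurableSet

theorem tailSet_succ_ae_eq (hS : S.IsIntermittent αm αp b ε) {α : ℝ} (hα : α ∈ Icc αm αp)
    (n : ℕ) : S.tailSet α (n + 1) =ᵐ[volume]
      (⋃ i ∈ Finset.Icc 2 S.m, S.I i ∩ S.belowSet α i (S.backOrbit α (n + 1)) : Set ℝ) := by
  have h0 : volume (S.exceptionalSet α) = 0 := (S.finite_exceptionalSet α).measure_zero _
  refine (sdiff_null_ae_eq_self h0).symm.trans ?_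
  rw [hS.tailSet_succ_diff hα]
  exact sdiff_null_ae_eq_self h0

/-- Points that never return to `Y` are exceptional, since the backward orbit of `1` tends to
`0`. -/
theorem iInter_tailSet_subset (hS : S.IsIntermittent αm αp b ε) (hαm : 0 < αm) (hαp : αm < αp)
    (hε : ε < αm) {α : ℝ} (hα : α ∈ Icc αm αp) : ⋂ n, S.tailSet α n ⊆ S.exceptionalSet α := by
  intro x hx
  by_contra hxe
  rw [mem_iInter] at hx
  obtain ⟨i, hi, hxi⟩ := hS.exists_mem_I (hx 0).1 hxe
  obtain ⟨D, hD, hz⟩ := hS.backOrbit_asymptotics hαm hαp hε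
  have hα0 : 0 < α := hαm.trans_le hα.1
  have hle : S.br α i x ≤ 0 := by
    have hlim : Filter.Tendsto (fun n : ℕ => D * ((n + 1 : ℕ) : ℝ) ^ (-(1 / α))) Filter.atTop
        (nhds (D * 0)) :=
      ((tendsto_rpow_neg_atTop (one_div_pos.2 hα0)).comp (tendsto_natCast_atTop_atTop.comp
        (Filter.tendsto_add_atTop_nat 1))).const_mul D
    rw [mul_zero] at hlim
    refine ge_of_tendsto' hlim fun n => ?_
    exact ((hS.mem_tailSet_succ_iff hα n hi hxi hxe).1 (hx (n + 1))).le.trans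
      (hz α hα (n + 1) (by omega)).1
  refine hxe (mem_iUnion₂.2 ⟨i, hi, Or.inr (Or.inr ?_)⟩)
  have hc := subset_closure hxi
  rw [mem_singleton_iff, ← hle.antisymm (hS.br_mem hα (mem_Icc_one hi) hc).1,
    hS.brInv_br hα (mem_Icc_one hi) hc]

theorem inducedMeasure_absolutelyContinuous (S : BranchedFamily) (h : ℝ → ℝ) :
    S.inducedMeasure h ≪ volume :=
  (withDensity_absolutelyContinuous _ _).trans
    ((Measure.smul_absolutelyContinuous).trans Measure.restrict_le_self.absolutelyContinuous)

/-- On the tail sets of the return time the SRB measure coincides with the induced measure: the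
pushforwards under `f^n`, `n ≥ 1`, are carried by orbits that have not yet returned to `Y`. -/
theorem srbMeasure_tailSet (hS : S.IsIntermittent αm αp b ε) (hαm : 0 < αm) (hαp : αm < αp)
    (hε : ε < αm) {α : ℝ} (hα : α ∈ Icc αm αp) (h : ℝ → ℝ) (n : ℕ) :
    S.srbMeasure α h (S.tailSet α n) = S.inducedMeasure h (S.tailSet α n) := by
  set μ := S.inducedMeasure h with hμ
  set A := S.tailSet α n with hA
  have hAm : MeasurableSet A := hS.measurableSet_tailSet hα n
  set T : ℕ → Set ℝ := fun N => {x | x ∈ S.Y ∧ S.returnTime α x = ((N + 1 : ℕ) : ℕ∞)} with hT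
  have hTm : ∀ N, MeasurableSet (T N) := fun N => by
    rw [hT]; simp only
    rw [returnTime_eq_succ_iff]
    exact (hS.measurableSet_tailSet hα _).diff (hS.measurableSet_tailSet hα _)
  have hTd : Pairwise (Function.onFun Disjoint T) := by
    intro N N' hne
    refine disjoint_left.2 fun x hx hx' => hne ?_
    have := hx.2.symm.trans hx'.2
    have : N + 1 = N' + 1 := by exact_mod_cast this
    omega
  rw [srbMeasure, Measure.sum_apply _ hAm, tsum_eq_single 0]
  · rw [Measure.sum_apply _ hAm]
    have h1 : ∀ j : ℕ, ((μ.restrict {x | x ∈ S.Y ∧ S.returnTime α x = ((0 + 1 + j : ℕ) : ℕ∞)}).map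
        (S.f α)^[0]) A = μ (A ∩ T j) := by
      intro j
      rw [Function.iterate_zero, Measure.map_id, Measure.restrict_apply hAm, hT, zero_add,
        add_comm 1 j]
    rw [tsum_congr h1, ← measure_iUnion
      (fun i j hij => (hTd hij).mono inter_subset_right inter_subset_right)
      (fun j => hAm.inter (hTm j)), ← inter_iUnion]
    refine le_antisymm (measure_mono inter_subset_left) ?_
    have hnull : μ (S.exceptionalSet α) = 0 :=
      inducedMeasure_absolutelyContinuous S h ((S.finite_exceptionalSet α).measure_zero _)
    -- the returning points of `A` exhaust it up to exceptional points
    have hcover : A ⊆ (A ∩ ⋃ N, T N) ∪ S.exceptionalSet α := by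
      intro x hx
      by_cases hxe : x ∈ S.exceptionalSet α
      · exact Or.inr hxe
      refine Or.inl ⟨hx, ?_⟩
      have hex : ∃ N, x ∉ S.tailSet α N := by
        by_contra! hall
        exact hxe (hS.iInter_tailSet_subset hαm hαp hε hα (mem_iInter.2 hall))
      classical
      obtain ⟨N, hN⟩ : ∃ N, Nat.find hex = N + 1 := by
        refine Nat.exists_eq_succ_of_ne_zero fun h0 => ?_
        have := Nat.find_spec hex
        rw [h0, tailSet_zero] at this
        exact this hx.1
      have h1 := Nat.find_spec hex
      have h2 : x ∈ S.tailSet α N := not_not.1 (Nat.find_min hex (m := N) (by omega))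
      rw [hN] at h1
      refine mem_iUnion.2 ⟨N, ?_⟩
      have h3 := S.returnTime_eq_succ_iff α N
      rw [hT]; simp only
      rw [h3]
      exact ⟨h2, h1⟩
    refine (measure_mono hcover).trans ((measure_union_le _ _).trans_eq ?_)
    rw [hnull, add_zero]
  · intro k hk
    rw [Measure.sum_apply _ hAm, ENNReal.tsum_eq_zero]
    intro j
    -- where `f^k` is not almost everywhere measurable, the pushforward is zero by definition
    by_cases hf : AEMeasurable (S.f α)^[k]
        (μ.restrict {x | x ∈ S.Y ∧ S.returnTime α x = ((k + 1 + j : ℕ) : ℕ∞)})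
    · have he : k + 1 + j = (k + j) + 1 := by ring
      rw [Measure.map_apply_of_aemeasurable hf hAm, he, Measure.restrict_apply' (hTm (k + j))]
      refine measure_mono_null ?_ (measure_empty (μ := μ))
      rintro x ⟨hx, hxT⟩
      have hlt : ((k : ℕ) : ℕ∞) < S.returnTime α x := by
        rw [hxT.2]; exact_mod_cast (by omega : k < k + j + 1)
      exact (S.lt_returnTime_iff α x k).1 hlt k (by omega) le_rfl hx.1
    · rw [Measure.map_of_not_aemeasurable hf]; rfl

end IsIntermittent
end BranchedFamily

/-! ### The measure of the tail sets -/

theorem setLIntegral_ofReal_near_const {φ : ℝ → ℝ} {s : Set ℝ} {c d z : ℝ} (hs : MeasurableSet s)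
    (hz : 0 ≤ z) (hsz : volume s = ENNReal.ofReal z) (hc : 0 ≤ c) (hd : 0 ≤ d)
    (hφ : ∀ y ∈ s, |φ y - c| ≤ d) :
    ∫⁻ y in s, ENNReal.ofReal (φ y) ≠ ⊤ ∧
      |(∫⁻ y in s, ENNReal.ofReal (φ y)).toReal - c * z| ≤ d * z := by
  have hup : ∫⁻ y in s, ENNReal.ofReal (φ y) ≤ ENNReal.ofReal ((c + d) * z) := by
    rw [ENNReal.ofReal_mul (by positivity), ← hsz, ← setLIntegral_const]
    exact setLIntegral_mono_ae' hs (Filter.Eventually.of_forall fun y hy =>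
      ENNReal.ofReal_le_ofReal (by linarith [(abs_le.1 (hφ y hy)).2]))
  have hlow : ENNReal.ofReal ((c - d) * z) ≤ ∫⁻ y in s, ENNReal.ofReal (φ y) := by
    rw [ENNReal.ofReal_mul' hz, ← hsz, ← setLIntegral_const]
    exact setLIntegral_mono_ae' hs (Filter.Eventually.of_forall fun y hy =>
      ENNReal.ofReal_le_ofReal (by linarith [(abs_le.1 (hφ y hy)).1]))
  have hfin : ∫⁻ y in s, ENNReal.ofReal (φ y) ≠ ⊤ := ne_top_of_le_ne_top ENNReal.ofReal_ne_top hup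
  refine ⟨hfin, ?_⟩
  have h1 := ENNReal.toReal_le_of_le_ofReal (by positivity) hup
  have h2 := (ENNReal.ofReal_le_iff_le_toReal hfin).1 hlow
  rw [abs_le]
  constructor <;> linarith

namespace BranchedFamily

/-- The density `|(f_{α,i}⁻¹)'| · h ∘ f_{α,i}⁻¹` of the image of `h` restricted to `I i` under the
`i`-th branch. -/
noncomputable def branchDensity (S : BranchedFamily) (α : ℝ) (h : ℝ → ℝ) (i : ℕ) (y : ℝ) : ℝ :=
  |derivWithin (S.brInv α i) (Icc 0 1) y| * h (S.brInv α i y)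

namespace IsIntermittent

variable {S : BranchedFamily} {αm αp : ℝ} {b : ℝ → ℝ} {ε : ℝ}

theorem derivWithin_brInv (hS : S.IsIntermittent αm αp b ε) {α : ℝ} (hα : α ∈ Icc αm αp)
    {i : ℕ} (hi : i ∈ Finset.Icc 1 S.m) {y : ℝ} (hy : y ∈ Icc (0 : ℝ) 1) :
    derivWithin (S.brInv α i) (Icc 0 1) y = (deriv (S.br α i) (S.brInv α i y))⁻¹ :=
  (hS.hasDerivWithinAt_brInv hα hi hy).derivWithin (uniqueDiffOn_Icc zero_lt_one y hy)

theorem abs_derivWithin_brInv_le_one (hS : S.IsIntermittent αm αp b ε) {α : ℝ}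
    (hα : α ∈ Icc αm αp) {i : ℕ} (hi : i ∈ Finset.Icc 1 S.m) {y : ℝ} (hy : y ∈ Icc (0 : ℝ) 1) :
    |derivWithin (S.brInv α i) (Icc 0 1) y| ≤ 1 := by
  rw [hS.derivWithin_brInv hα hi hy, abs_inv]
  exact inv_le_one_of_one_le₀ (hS.one_le_abs_deriv_br hα hi (hS.brInv_mem hα hi hy))

theorem abs_brInv_sub_le_abs_sub (hS : S.IsIntermittent αm αp b ε) {α : ℝ} (hα : α ∈ Icc αm αp)
    {i : ℕ} (hi : i ∈ Finset.Icc 1 S.m) {x y : ℝ} (hx : x ∈ Icc (0 : ℝ) 1)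
    (hy : y ∈ Icc (0 : ℝ) 1) : |S.brInv α i x - S.brInv α i y| ≤ |x - y| := by
  simpa using hS.abs_brInv_sub_le hα hi one_pos
    (fun z hz => hS.one_le_abs_deriv_br hα hi hz) hx hy

theorem exists_lipschitz_deriv_br (hS : S.IsIntermittent αm αp b ε) :
    ∃ M : ℝ, 0 ≤ M ∧ ∀ α ∈ Icc αm αp, ∀ i ∈ Finset.Icc 2 S.m, ∀ x ∈ closure (S.I i),
      ∀ y ∈ closure (S.I i), |deriv (S.br α i) x - deriv (S.br α i) y| ≤ M * |x - y| := by
  have hne : ∀ i ∈ Finset.Icc 2 S.m, i ≠ 1 := fun i hi => by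
    have := (Finset.mem_Icc.1 hi).1; omega
  have hbound : ∀ i : ℕ, ∃ M : ℝ, 0 ≤ M ∧ (i ∈ Finset.Icc 2 S.m → ∀ α ∈ Icc αm αp,
      ∀ x ∈ closure (S.I i), |iteratedDeriv 2 (S.br α i) x| ≤ M) := by
    intro i
    by_cases hi : i ∈ Finset.Icc 2 S.m
    · have hc := hS.continuous_deriv2 i (mem_Icc_one hi)
      have hr : S.regularPart i = closure (S.I i) := by
        rw [regularPart, sdiff_eq_left]
        exact disjoint_left.2 fun x _ hx => hne i hi hx.1
      rw [hr] at hc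
      obtain ⟨M, hM⟩ := (isCompact_Icc.prod
        (hS.isCompact_closure (mem_Icc_one hi))).exists_bound_of_continuousOn hc
      exact ⟨max M 0, le_max_right _ _, fun _ α hα x hx => (hM (α, x) ⟨hα, hx⟩).trans
        (le_max_left _ _)⟩
    · exact ⟨0, le_rfl, fun h => absurd h hi⟩
  choose M hM0 hM using hbound
  refine ⟨∑ i ∈ Finset.Icc 2 S.m, M i, Finset.sum_nonneg fun i _ => hM0 i, ?_⟩
  intro α hα i hi x hx y hy
  obtain ⟨W, hW, hWsub, -, -, h3, -⟩ := hS.extends_diffeo α hα i (mem_Icc_one hi)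
  have hWe : W \ {x | i = 1 ∧ x = 0} = W := by
    rw [sdiff_eq_left]
    exact disjoint_left.2 fun x _ hx => hne i hi hx.1
  rw [hWe] at h3
  have hd : DifferentiableOn ℝ (deriv (S.br α i)) W :=
    (h3.deriv_of_isOpen (m := 2) hW (by norm_num)).differentiableOn two_ne_zero
  have hconv : Convex ℝ (closure (S.I i)) := by
    rw [hS.closure_I (mem_Icc_one hi)]; exact convex_Icc _ _
  have := Convex.norm_image_sub_le_of_norm_hasDerivWithin_le (f := deriv (S.br α i))
    (fun z hz => ((hd z (hWsub hz)).differentiableAt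
      (hW.mem_nhds (hWsub hz))).hasDerivAt.hasDerivWithinAt) (C := ∑ i ∈ Finset.Icc 2 S.m, M i)
    (fun z hz => ?_) hconv hy hx
  · simpa [Real.norm_eq_abs] using this
  · have h2 := hM i hi α hα z hz
    rw [iteratedDeriv_succ, iteratedDeriv_one] at h2
    exact h2.trans (Finset.single_le_sum (fun i _ => hM0 i) hi)

/-- The image densities `|(f_{α,i}⁻¹)'| · h ∘ f_{α,i}⁻¹` are bounded at `0` and vary at most
linearly from there, uniformly in the parameter. -/
theorem exists_branchDensity_bounds (hS : S.IsIntermittent αm αp b ε) :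
    ∃ M : ℝ, 0 < M ∧ ∀ α ∈ Icc αm αp, ∀ h : ℝ → ℝ, S.IsInvariantDensity α h →
      ∀ i ∈ Finset.Icc 2 S.m, ∀ y ∈ Icc (0 : ℝ) 1,
        0 ≤ S.branchDensity α h i 0 ∧ S.branchDensity α h i 0 ≤ M ∧
        |S.branchDensity α h i y - S.branchDensity α h i 0| ≤ M * y := by
  obtain ⟨M₁, hM₁, hbr⟩ := hS.exists_lipschitz_deriv_br
  obtain ⟨M₂, hM₂, hden⟩ := hS.exists_density_bounds
  refine ⟨M₂ * (1 + M₁), by positivity, fun α hα h hh i hi y hy => ?_⟩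
  obtain ⟨hb, hlip⟩ := hden α hα h hh
  have hi1 := mem_Icc_one hi
  have h0 : (0 : ℝ) ∈ Icc (0 : ℝ) 1 := left_mem_Icc.2 zero_le_one
  have hpc := hS.brInv_mem hα hi1 h0
  have hqc := hS.brInv_mem hα hi1 hy
  have hpY : S.brInv α i 0 ∈ S.Y := mem_iUnion₂.2 ⟨i, hi, hpc⟩
  have hqY : S.brInv α i y ∈ S.Y := mem_iUnion₂.2 ⟨i, hi, hqc⟩
  have hd0 := hS.abs_derivWithin_brInv_le_one hα hi1 h0
  have hdy := hS.abs_derivWithin_brInv_le_one hα hi1 hy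
  have hpq : |S.brInv α i y - S.brInv α i 0| ≤ y := by
    have := hS.abs_brInv_sub_le_abs_sub hα hi1 hy h0
    rwa [sub_zero, abs_of_nonneg hy.1] at this
  have hdd : |(|derivWithin (S.brInv α i) (Icc 0 1) y| - |derivWithin (S.brInv α i) (Icc 0 1) 0|)|
      ≤ M₁ * y := by
    rw [hS.derivWithin_brInv hα hi1 hy, hS.derivWithin_brInv hα hi1 h0]
    refine (abs_abs_sub_abs_le_abs_sub _ _).trans ?_
    rw [inv_sub_inv (hS.deriv_br_ne_zero hα hi1 hqc) (hS.deriv_br_ne_zero hα hi1 hpc), abs_div,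
      abs_mul]
    have h1 := hS.one_le_abs_deriv_br hα hi1 hqc
    have h2 := hS.one_le_abs_deriv_br hα hi1 hpc
    refine (div_le_self (abs_nonneg _) (one_le_mul_of_one_le_of_one_le h1 h2)).trans ?_
    rw [abs_sub_comm]
    exact (hbr α hα i hi _ hqc _ hpc).trans (by gcongr)
  obtain ⟨hh0, hhM⟩ := hb _ hpY
  refine ⟨mul_nonneg (abs_nonneg _) hh0.le, ?_, ?_⟩
  · calc S.branchDensity α h i 0 ≤ 1 * M₂ := mul_le_mul hd0 hhM hh0.le zero_le_one
      _ ≤ M₂ * (1 + M₁) := by nlinarith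
  · have e : S.branchDensity α h i y - S.branchDensity α h i 0
        = |derivWithin (S.brInv α i) (Icc 0 1) y| * (h (S.brInv α i y) - h (S.brInv α i 0))
          + (|derivWithin (S.brInv α i) (Icc 0 1) y| - |derivWithin (S.brInv α i) (Icc 0 1) 0|)
            * h (S.brInv α i 0) := by
      rw [branchDensity, branchDensity]; ring
    rw [e]
    refine (abs_add_le _ _).trans ?_
    rw [abs_mul, abs_mul, abs_abs, abs_of_pos hh0]
    have h1 : |derivWithin (S.brInv α i) (Icc 0 1) y| * |h (S.brInv α i y) - h (S.brInv α i 0)|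
        ≤ 1 * (M₂ * y) :=
      mul_le_mul hdy ((hlip _ hqY _ hpY).trans (by gcongr)) (abs_nonneg _) zero_le_one
    have h2 : |(|derivWithin (S.brInv α i) (Icc 0 1) y|
        - |derivWithin (S.brInv α i) (Icc 0 1) 0|)| * h (S.brInv α i 0) ≤ M₁ * y * M₂ :=
      mul_le_mul hdd hhM hh0.le (mul_nonneg hM₁ hy.1)
    linarith

theorem belowSet_eq_image (hS : S.IsIntermittent αm αp b ε) {α : ℝ} (hα : α ∈ Icc αm αp)
    {i : ℕ} (hi : i ∈ Finset.Icc 1 S.m) {z : ℝ} (hz : z ≤ 1) :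
    S.belowSet α i z = S.brInv α i '' Ico 0 z := by
  ext x
  constructor
  · rintro ⟨hxc, hxz⟩
    exact ⟨S.br α i x, ⟨(hS.br_mem hα hi hxc).1, hxz⟩, hS.brInv_br hα hi hxc⟩
  · rintro ⟨y, hy, rfl⟩
    have hy1 : y ∈ Icc (0 : ℝ) 1 := ⟨hy.1, hy.2.le.trans hz⟩
    refine ⟨hS.brInv_mem hα hi hy1, ?_⟩
    rw [mem_preimage, hS.br_brInv hα hi hy1]
    exact hy.2

/-- The change of variables by the `i`-th inverse branch. -/
theorem lintegral_I_inter_belowSet (hS : S.IsIntermittent αm αp b ε) {α : ℝ} (hα : α ∈ Icc αm αp)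
    {i : ℕ} (hi : i ∈ Finset.Icc 1 S.m) {z : ℝ} (hz : z ≤ 1) (h : ℝ → ℝ) :
    ∫⁻ x in S.I i ∩ S.belowSet α i z, ENNReal.ofReal (h x)
      = ∫⁻ y in Ico 0 z, ENNReal.ofReal (S.branchDensity α h i y) := by
  have hsub : Ico 0 z ⊆ Icc (0 : ℝ) 1 := fun y hy => ⟨hy.1, hy.2.le.trans hz⟩
  have hae : (S.I i ∩ S.belowSet α i z : Set ℝ) =ᵐ[volume] S.belowSet α i z := by
    have hfin : (({S.left i, S.right i} : Set ℝ)).Finite := by simp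
    have hsub2 : S.belowSet α i z \ {S.left i, S.right i} ⊆ S.I i ∩ S.belowSet α i z := by
      rintro x ⟨hx, hxe⟩
      refine ⟨hS.Ioo_subset hi ?_, hx⟩
      have hxc := hx.1
      rw [hS.closure_I hi] at hxc
      exact ⟨lt_of_le_of_ne hxc.1 fun h => hxe (Or.inl h.symm),
        lt_of_le_of_ne hxc.2 fun h => hxe (Or.inr h)⟩
    refine Filter.EventuallyLE.antisymm (LE.le.eventuallyLE inter_subset_right) ?_
    exact (sdiff_null_ae_eq_self (hfin.measure_zero _)).symm.le.trans
      (LE.le.eventuallyLE hsub2)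
  rw [setLIntegral_congr hae, hS.belowSet_eq_image hα hi hz,
    lintegral_image_eq_lintegral_abs_deriv_mul measurableSet_Ico
      (f' := derivWithin (S.brInv α i) (Icc 0 1)) (fun y hy => ?_) ?_]
  · refine setLIntegral_congr_fun measurableSet_Ico fun y _ => ?_
    exact (ENNReal.ofReal_mul (abs_nonneg _)).symm
  · intro x hx y hy hxy
    rw [← hS.br_brInv hα hi (hsub hx), hxy, hS.br_brInv hα hi (hsub hy)]
  · exact (hS.hasDerivWithinAt_brInv hα hi (hsub hy)).differentiableWithinAt.hasDerivWithinAt.mono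
      hsub

theorem inducedMeasure_tailSet (hS : S.IsIntermittent αm αp b ε) {α : ℝ} (hα : α ∈ Icc αm αp)
    (h : ℝ → ℝ) (n : ℕ) : S.inducedMeasure h (S.tailSet α (n + 1))
      = (volume S.Y)⁻¹ * ∑ i ∈ Finset.Icc 2 S.m,
          ∫⁻ y in Ico 0 (S.backOrbit α (n + 1)), ENNReal.ofReal (S.branchDensity α h i y) := by
  rw [inducedMeasure_apply h (hS.measurableSet_tailSet hα _) (fun x hx => hx.1),
    setLIntegral_congr (hS.tailSet_succ_ae_eq hα n), lintegral_biUnion_finset]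
  · congr 1
    exact Finset.sum_congr rfl fun i hi => hS.lintegral_I_inter_belowSet hα (mem_Icc_one hi)
      (hS.backOrbit_mem hα _).2 h
  · intro i hi j hj hij
    exact (hS.disjoint i (mem_Icc_one hi) j (mem_Icc_one hj) hij).mono inter_subset_left
      inter_subset_left
  · exact fun i hi => hS.measurableSet_I_inter_belowSet hα (mem_Icc_one hi) _

/-- The induced measure of a tail set is, to first order in the corresponding point `z` of the
backward orbit, the sum of the image densities at `0` times `z / λ(Y)`. -/
theorem exists_inducedMeasure_tailSet_sub_le (hS : S.IsIntermittent αm αp b ε) :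
    ∃ M : ℝ, 0 < M ∧ ∀ α ∈ Icc αm αp, ∀ h : ℝ → ℝ, S.IsInvariantDensity α h →
      |∑ i ∈ Finset.Icc 2 S.m, S.branchDensity α h i 0| ≤ M ∧ ∀ n : ℕ,
      S.inducedMeasure h (S.tailSet α (n + 1)) ≠ ⊤ ∧
      |(S.inducedMeasure h (S.tailSet α (n + 1))).toReal
          - (volume S.Y).toReal⁻¹ * (∑ i ∈ Finset.Icc 2 S.m, S.branchDensity α h i 0)
            * S.backOrbit α (n + 1)|
        ≤ (volume S.Y).toReal⁻¹ * M * S.backOrbit α (n + 1) ^ 2 := by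
  obtain ⟨M, hM, hbd⟩ := hS.exists_branchDensity_bounds
  have hm : 0 < ((Finset.Icc 2 S.m).card : ℝ) := by
    rw [Nat.cast_pos, Finset.card_pos]
    exact ⟨2, Finset.mem_Icc.2 ⟨le_rfl, hS.two_le⟩⟩
  refine ⟨(Finset.Icc 2 S.m).card * M, by positivity, fun α hα h hh => ⟨?_, fun n => ?_⟩⟩
  · refine (Finset.abs_sum_le_sum_abs _ _).trans ?_
    rw [← nsmul_eq_mul]
    refine Finset.sum_le_card_nsmul _ _ _ fun i hi => ?_
    obtain ⟨h0, h1, -⟩ := hbd α hα h hh i hi 0 (left_mem_Icc.2 zero_le_one)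
    rwa [abs_of_nonneg h0]
  set z := S.backOrbit α (n + 1) with hz
  have hz01 := hS.backOrbit_mem hα (n + 1)
  rw [← hz] at hz01
  have hvol : volume (Ico 0 z) = ENNReal.ofReal z := by rw [Real.volume_Ico, sub_zero]
  have hint : ∀ i ∈ Finset.Icc 2 S.m,
      ∫⁻ y in Ico 0 z, ENNReal.ofReal (S.branchDensity α h i y) ≠ ⊤ ∧
      |(∫⁻ y in Ico 0 z, ENNReal.ofReal (S.branchDensity α h i y)).toReal
        - S.branchDensity α h i 0 * z| ≤ M * z * z := by
    intro i hi
    refine setLIntegral_ofReal_near_const measurableSet_Ico hz01.1.le hvol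
      (hbd α hα h hh i hi 0 (left_mem_Icc.2 zero_le_one)).1 (mul_nonneg hM.le hz01.1.le)
      fun y hy => ?_
    refine (hbd α hα h hh i hi y ⟨hy.1, hy.2.le.trans hz01.2⟩).2.2.trans ?_
    have := hy.2.le
    gcongr
  have hY0 : volume S.Y ≠ 0 := by
    rw [hS.volume_Y, ne_eq, ENNReal.ofReal_eq_zero, not_le, sub_pos]
    exact hS.right_one_lt_one
  rw [hS.inducedMeasure_tailSet hα]
  refine ⟨ENNReal.mul_ne_top (ENNReal.inv_ne_top.2 hY0)
    (ENNReal.sum_ne_top.2 fun i hi => (hint i hi).1), ?_⟩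
  rw [ENNReal.toReal_mul, ENNReal.toReal_inv, ENNReal.toReal_sum fun i hi => (hint i hi).1,
    mul_assoc, ← mul_sub, Finset.sum_mul, ← Finset.sum_sub_distrib, abs_mul,
    abs_of_nonneg (inv_nonneg.2 ENNReal.toReal_nonneg), mul_assoc]
  refine mul_le_mul_of_nonneg_left ?_ (inv_nonneg.2 ENNReal.toReal_nonneg)
  refine (Finset.abs_sum_le_sum_abs _ _).trans ?_
  rw [mul_assoc, ← nsmul_eq_mul]
  refine Finset.sum_le_card_nsmul _ _ _ fun i hi => ?_
  exact (hint i hi).2.trans_eq (by ring)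

theorem tailCoeff_eq (hS : S.IsIntermittent αm αp b ε) (hαm : 0 < αm) {α : ℝ}
    (hα : α ∈ Icc αm αp) (h : ℝ → ℝ) : S.tailCoeff b α h
      = (volume S.Y).toReal⁻¹ * (∑ i ∈ Finset.Icc 2 S.m, S.branchDensity α h i 0)
          * (α * b α) ^ (-(1 / α)) := by
  have hα0 : 0 < α := hαm.trans_le hα.1
  rw [tailCoeff, Real.rpow_neg (mul_nonneg hα0.le (hS.b_pos α hα).le), div_eq_mul_inv]
  congr 2
  exact Finset.sum_congr rfl fun i _ => mul_comm _ _

end IsIntermittent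
end BranchedFamily

theorem mainTheorem5 (αm αp : ℝ) (hαm : 0 < αm) (hαp : αm < αp)
    (S : BranchedFamily) (b : ℝ → ℝ) (ε : ℝ) (hS : S.IsIntermittent αm αp b ε)
    (hε : ε < αm) (hε_one : ε ≤ 1) :
    ∃ D : ℝ, 0 < D ∧ ∀ α ∈ Set.Icc αm αp, ∀ h : ℝ → ℝ, S.IsInvariantDensity α h →
      ∀ n : ℕ, 1 ≤ n →
        S.srbMeasure α h {x | x ∈ S.Y ∧ (n : ℕ∞) < S.returnTime α x} ≠ ⊤ ∧
        |(S.srbMeasure α h {x | x ∈ S.Y ∧ (n : ℕ∞) < S.returnTime α x}).toReal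
            - S.tailCoeff b α h * (n : ℝ) ^ (-(1 / α))|
          ≤ D * (n : ℝ) ^ (-((1 + ε) / α)) := by
  obtain ⟨D, hD, hz⟩ := hS.backOrbit_asymptotics hαm hαp hε
  obtain ⟨M, hM, hμ⟩ := hS.exists_inducedMeasure_tailSet_sub_le
  have hV : 0 < (volume S.Y).toReal⁻¹ := by
    rw [hS.volume_Y, ENNReal.toReal_ofReal (sub_pos.2 hS.right_one_lt_one).le, inv_pos, sub_pos]
    exact hS.right_one_lt_one
  set V := (volume S.Y).toReal⁻¹ with hVdef
  refine ⟨V * M * D ^ 2 + V * M * D, by positivity, fun α hα h hh n hn => ?_⟩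
  change S.srbMeasure α h (S.tailSet α n) ≠ ⊤ ∧
    |(S.srbMeasure α h (S.tailSet α n)).toReal - _| ≤ _
  rw [hS.srbMeasure_tailSet hαm hαp hε hα h n, hS.tailCoeff_eq hαm hα h, ← hVdef]
  obtain ⟨hz1, hz2⟩ := hz α hα n hn
  have hz0 := (hS.backOrbit_mem hα n).1
  have hα0 : 0 < α := hαm.trans_le hα.1
  obtain ⟨hsum, hμ'⟩ := hμ α hα h hh
  obtain ⟨k, rfl⟩ := Nat.exists_eq_add_of_le' hn
  obtain ⟨hfin, hmain⟩ := hμ' k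
  refine ⟨hfin, ?_⟩
  generalize (S.inducedMeasure h (S.tailSet α (k + 1))).toReal = X at *
  generalize (∑ i ∈ Finset.Icc 2 S.m, S.branchDensity α h i 0) = Φ at *
  generalize S.backOrbit α (k + 1) = z at *
  generalize hnn : ((k + 1 : ℕ) : ℝ) = N at *
  have hN1 : 1 ≤ N := by rw [← hnn]; exact_mod_cast hn
  have hN0 : 0 < N := by linarith
  -- the quadratic error is `O(n^(-2/α))`, which is `O(n^(-(1+ε)/α))` because `ε ≤ 1`
  have hsq : z ^ 2 ≤ D ^ 2 * N ^ (-((1 + ε) / α)) := by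
    calc z ^ 2 ≤ (D * N ^ (-(1 / α))) ^ 2 := by gcongr
      _ = D ^ 2 * N ^ (-(2 / α)) := by
          rw [mul_pow, sq (N ^ (-(1 / α))), ← Real.rpow_add hN0]; congr 2; ring
      _ ≤ D ^ 2 * N ^ (-((1 + ε) / α)) := by
          gcongr D ^ 2 * ?_
          refine Real.rpow_le_rpow_of_exponent_le hN1 (neg_le_neg ?_)
          gcongr; linarith
  have e : X - V * Φ * (α * b α) ^ (-(1 / α)) * N ^ (-(1 / α))
      = (X - V * Φ * z) + V * Φ * (z - (α * b α) ^ (-(1 / α)) * N ^ (-(1 / α))) := by ring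
  rw [e, add_mul]
  refine (abs_add_le _ _).trans (add_le_add ?_ ?_)
  · refine hmain.trans ?_
    rw [mul_assoc (V * M)]
    gcongr
  · rw [abs_mul, abs_mul, abs_of_pos hV, mul_assoc (V * M)]
    exact mul_le_mul (by gcongr) hz2 (abs_nonneg _) (by positivity)
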